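/- **Theorem 2.3.** Let $\zeta_{AV,2}(s_1,s_2,s_3)$ denote the Apostol–Vu double zeta-function, i.e. the analytic continuation of $$\sum_{m=1}^{\infty}\sum_{1\le n<m}\frac{1}{m^{s_1}n^{s_2}(m+n)^{s_3}}\qquad(\operatorname{Re}s_j>1,\ j=1,2,3)$$ as a holomorphic function of $(s_1,s_2,s_3)$ in the domain $\operatorname{Re}(s_1+s_3)>0$, $\operatorname{Re}(s_1+s_2+s_3)>1$, $s_1+s_3\ne 1$, $s_1+s_2+s_3\ne 2$ (this continuation exists and is unique). Write $s_j=\sigma_j+it_j$ with $\sigma_j,t_j\in\mathbb{R}$. Fix $s_1,s_2\in\mathbb{C}$ and $\sigma_3\in\mathbb{R}$ with $$\sigma_1\ge 0,\qquad t_1\ge 0,\qquad \sigma_3>\max\{0,\ \tfrac12-\sigma_1,\ \tfrac32-\sigma_1-\sigma_2\},$$ and put $a=\max\{1,|t_1|\}$. Let $\delta>0$. Then for all $t_3\ge 2$ such that $s_1+s_3\ne 1$ and $|s_1+s_2+s_3-2|\ge\delta$, where $s_3=\sigma_3+it_3$, $$\zeta_{AV,2}(s_1,s_2,s_3)=\sum_{1\le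 m\le at_3}\ \sum_{1\le n<m}\frac{1}{m^{s_1}n^{s_2}(m+n)^{s_3}}+\begin{cases}O\bigl(t_3^{1/2-\sigma_1-\sigma_3}\bigr)&(\sigma_2>\tfrac32),\\ O\bigl(t_3^{1/2-\sigma_1-\sigma_3}\log t_3\bigr)&(\sigma_2=\tfrac32),\\ O\bigl(t_3^{3/2-\sigma_1-\sigma_2-\sigma_3}\bigr)&(\sigma_2<\tfrac32),\end{cases}$$ where the implicit constants depend only on $s_1,s_2,\sigma_3$ and $\delta$. In particular, if the point $(s_1,s_2,\sigma_3+it_3)$ does not meet the hyperplane $s_1+s_2+s_3=2$ for any $t_3\ge2$, the estimate holds for all $t_3\ge 2$ with constants depending only on $s_1,s_2,\sigma_3$. -/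

import Mathlib

/-- The inner finite sum `∑_{1 ≤ n < m} 1 / (m^{s₁} n^{s₂} (m+n)^{s₃})`. -/
noncomputable def avInner (s₁ s₂ s₃ : ℂ) (m : ℕ) : ℂ :=
  ∑ n ∈ Finset.Ico 1 m, 1 / ((m : ℂ) ^ s₁ * (n : ℂ) ^ s₂ * ((m + n : ℕ) : ℂ) ^ s₃)

/-- The Apostol-Vu double series `∑_{m ≥ 1} ∑_{n < m} 1 / (m^{s₁} n^{s₂} (m+n)^{s₃})`
(the term of index `0` is an empty sum). -/
noncomputable def avSeries (s₁ s₂ s₃ : ℂ) : ℂ :=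
  ∑' m : ℕ, avInner s₁ s₂ s₃ m

/-- The truncated sum over `1 ≤ m ≤ x` and `1 ≤ n < m`. -/
noncomputable def avTruncated (x : ℝ) (s₁ s₂ s₃ : ℂ) : ℂ :=
  ∑ m ∈ Finset.Icc 1 ⌊x⌋₊, avInner s₁ s₂ s₃ m

/-- The domain `σ₁ + σ₃ > 0`, `σ₁ + σ₂ + σ₃ > 1` with the hyperplanes `s₁ + s₃ = 1` and
`s₁ + s₂ + s₃ = 2` removed.  These are the only two of the singular hyperplanes
`s₁ + s₃ = 1 - l`, `s₁ + s₂ + s₃ = 2 - l` (`l = 0, 1, 2, …`) that meet the half-spaces.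
The domain is open and connected. -/
def avDomain : Set (ℂ × ℂ × ℂ) :=
  {s | 0 < s.1.re + s.2.2.re ∧ 1 < s.1.re + s.2.1.re + s.2.2.re ∧
    s.1 + s.2.2 ≠ 1 ∧ s.1 + s.2.1 + s.2.2 ≠ 2}

/-- `Z` is a holomorphic continuation of the Apostol-Vu double series from the region
`σ₁, σ₂, σ₃ > 1` to `avDomain`: a function of three complex variables that is complex
differentiable on this open set and equals the series on the region.  By the identity theorem
its values on `avDomain` are unique, so they are those of the meromorphic continuation
to all of `ℂ³`. -/
structure IsAVContinuation (Z : ℂ → ℂ → ℂ → ℂ) : Prop where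
  holomorphic : DifferentiableOn ℂ (fun s : ℂ × ℂ × ℂ => Z s.1 s.2.1 s.2.2) avDomain
  eq_series : ∀ s₁ s₂ s₃ : ℂ, 1 < s₁.re → 1 < s₂.re → 1 < s₃.re →
    Z s₁ s₂ s₃ = avSeries s₁ s₂ s₃

open Classical in
/-- The Apostol-Vu double zeta-function: the analytic continuation of the series to `avDomain`
(only its values there are meaningful). -/
noncomputable def zetaAV (s₁ s₂ s₃ : ℂ) : ℂ :=
  if h : ∃ Z, IsAVContinuation Z then h.choose s₁ s₂ s₃ else 0

/-- The order of the error term, in the three cases `σ₂ > 3/2`, `σ₂ = 3/2`, `σ₂ < 3/2`. -/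
noncomputable def avErrorOrder (σ₁ σ₂ σ₃ t : ℝ) : ℝ :=
  if 3 / 2 < σ₂ then t ^ (1 / 2 - σ₁ - σ₃)
  else if σ₂ = 3 / 2 then t ^ (1 / 2 - σ₁ - σ₃) * Real.log t
  else t ^ (3 / 2 - σ₁ - σ₂ - σ₃)

open Set Filter Topology MeasureTheory

/-! For fixed `n` the sum over `m` is compared with an integral. One partial integration continues
the integral of the kernel over `(X, ∞)` to σ₁ + σ₃ > 0 (`avTail`), and the unit-step differences
between value and integral (`avStep`) are O(x^{-σ₁-σ₃-1}) by the mean value inequality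
(`norm_avStep_le`). Hence `avTail` plus the sum of `avStep` is a regularised value of the sum over m
≥ X. Take X = n and sum against n^{-s₂}. By homogeneity the tails add up to a constant times
ζ(s₁+s₂+s₃-1), the superfluous diagonal m = n gives 2^{-s₃} ζ(s₁+s₂+s₃), and the differences form a
double series converging absolutely on the domain. This is `avCont`; it is identified with `zetaAV`
by the identity theorem along segments (`IsAVContinuation.eq`).

For the error term, splitting off all m ≤ N = ⌊a t₃⌋ leaves only tails beyond X = N + 1
(`avCont_sub_sum_avInner`). There the phase of the kernel advances by at most π/2 per unit step, and
since t₁ ≥ 0 both factors turn in the same direction, so nothing is stationary. The first derivative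
test then gains a factor t₃ over the trivial bounds, twice: `avTail` is O(X^{1-σ₁-σ₃}/t₃) by partial
integration (`exists_norm_avTail_le`), and the sum of differences is O(X^{-σ₁-σ₃}) by Abel summation
in the manner of Kusmin and Landau (`exists_norm_tsum_avStep_le`). As X is comparable to t₃, each n
≤ N costs n^{-σ₂} t₃^{-σ₁-σ₃}, and everything else costs t₃^{1-σ₁-σ₂-σ₃}. A crude bound for the sum
of n^{-σ₂} settles all three cases at once. -/

/-- The summand `x^{-s₁} (x+n)^{-s₃}` as a function of the real variable `x`. -/
noncomputable def avKern (s₁ s₃ : ℂ) (n x : ℝ) : ℂ :=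
  (x : ℂ) ^ (-s₁) * ((x + n : ℝ) : ℂ) ^ (-s₃)

/-- The continuation of `∫_X^∞ x^{-s₁} (x+n)^{-s₃} dx` to `σ₁ + σ₃ > 0`, by partial integration. -/
noncomputable def avTail (s₁ s₃ : ℂ) (n X : ℝ) : ℂ :=
  (avKern (s₁ - 1) s₃ n X + s₃ * n * ∫ u in Ioi X, avKern s₁ (s₃ + 1) n u) / (s₁ + s₃ - 1)

/-- The difference between the value of the kernel at `x` and its integral over `[x, x+1]`. -/
noncomputable def avStep (s₁ s₃ : ℂ) (n x : ℝ) : ℂ :=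
  avKern s₁ s₃ n x - (avTail s₁ s₃ n x - avTail s₁ s₃ n (x + 1))

/-! ### The kernel, its continued tail integral and the unit-step differences -/

lemma norm_avKern (s₁ s₃ : ℂ) {n x : ℝ} (hn : 0 ≤ n) (hx : 0 < x) :
    ‖avKern s₁ s₃ n x‖ = x ^ (-s₁.re) * (x + n) ^ (-s₃.re) := by
  rw [avKern, norm_mul, Complex.norm_cpow_eq_rpow_re_of_pos hx,
    Complex.norm_cpow_eq_rpow_re_of_pos (by positivity), Complex.neg_re, Complex.neg_re]

/-- Here x ≤ x + n ≤ 2x, and the exponent |τ| covers both signs of τ. The gain is uniformity in `n`.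
-/
lemma rpow_add_le_two_rpow_abs_mul (τ : ℝ) {n x : ℝ} (hn : 0 ≤ n) (hnx : n ≤ x) (hx : 0 < x) :
    (x + n) ^ (-τ) ≤ 2 ^ |τ| * x ^ (-τ) := by
  have h2 : (1 : ℝ) ≤ 2 ^ |τ| := Real.one_le_rpow (by norm_num) (abs_nonneg _)
  rcases le_total 0 τ with h | h
  · calc (x + n) ^ (-τ) ≤ x ^ (-τ) :=
        Real.rpow_le_rpow_of_nonpos hx (by linarith) (by linarith)
      _ ≤ _ := le_mul_of_one_le_left (by positivity) h2
  · calc (x + n) ^ (-τ) ≤ (2 * x) ^ (-τ) :=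
        Real.rpow_le_rpow (by positivity) (by linarith) (by linarith)
      _ = _ := by rw [Real.mul_rpow (by norm_num) hx.le, abs_of_nonpos h]

lemma norm_avKern_le (s₁ s₃ : ℂ) {n x : ℝ} (hn : 0 ≤ n) (hnx : n ≤ x) (hx : 0 < x) :
    ‖avKern s₁ s₃ n x‖ ≤ 2 ^ |s₃.re| * x ^ (-(s₁.re + s₃.re)) := by
  rw [norm_avKern _ _ hn hx, neg_add, Real.rpow_add hx]
  have := mul_le_mul_of_nonneg_left (rpow_add_le_two_rpow_abs_mul s₃.re hn hnx hx)
    (Real.rpow_nonneg hx.le (-s₁.re))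
  linarith

lemma hasDerivAt_avKern (s₁ s₃ : ℂ) {n x : ℝ} (hn : 0 ≤ n) (hx : 0 < x) :
    HasDerivAt (avKern s₁ s₃ n)
      (-s₁ * avKern (s₁ + 1) s₃ n x - s₃ * avKern s₁ (s₃ + 1) n x) x := by
  have key : ∀ (a : ℂ) {y : ℝ}, 0 < y →
      HasDerivAt (fun y : ℝ => (y : ℂ) ^ (-a)) (-a * (y : ℂ) ^ (-a - 1)) y := fun a y hy => by
    have := ((hasDerivAt_id (y : ℂ)).cpow_const (c := -a) (Or.inl (by simpa using hy))).comp_ofReal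
    simpa using this
  have h1 := key s₁ hx
  have h3 := (key s₃ (show 0 < x + n by positivity)).comp_add_const x n
  convert! h1.mul h3 using 1
  simp only [avKern]
  rw [show -(s₁ + 1) = -s₁ - 1 by ring, show -(s₃ + 1) = -s₃ - 1 by ring]
  ring

lemma avKern_sub_one_left (s₁ s₃ : ℂ) {n x : ℝ} (hx : 0 < x) :
    avKern (s₁ - 1) s₃ n x = x * avKern s₁ s₃ n x := by
  have : (x : ℂ) ≠ 0 := by exact_mod_cast hx.ne'
  rw [avKern, avKern, show -(s₁ - 1) = -s₁ + 1 by ring, Complex.cpow_add _ _ this,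
    Complex.cpow_one]
  ring

lemma avKern_eq_add_mul (s₁ s₃ : ℂ) {n x : ℝ} (hn : 0 ≤ n) (hx : 0 < x) :
    avKern s₁ s₃ n x = (x + n) * avKern s₁ (s₃ + 1) n x := by
  have : ((x + n : ℝ) : ℂ) ≠ 0 := by exact_mod_cast (by positivity : 0 < x + n).ne'
  rw [avKern, avKern, show -s₃ = -(s₃ + 1) + 1 by ring, Complex.cpow_add _ _ this,
    Complex.cpow_one]
  push_cast
  ring

lemma continuousOn_avKern (s₁ s₃ : ℂ) {n : ℝ} (hn : 0 ≤ n) :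
    ContinuousOn (avKern s₁ s₃ n) (Ioi 0) := fun _ hx =>
  (hasDerivAt_avKern s₁ s₃ hn hx).continuousAt.continuousWithinAt

lemma integrableOn_avKern {s₁ s₃ : ℂ} {n X : ℝ} (hn : 0 ≤ n) (hX : 0 < X)
    (hs : 1 < s₁.re + s₃.re) : IntegrableOn (avKern s₁ s₃ n) (Ioi X) := by
  have hloc : ∀ Y, X ≤ Y → IntegrableOn (avKern s₁ s₃ n) (Ioc X Y) := fun Y hY =>
    (((continuousOn_avKern s₁ s₃ hn).mono
      fun x hx => lt_of_lt_of_le hX hx.1).integrableOn_Icc).mono_set Ioc_subset_Icc_self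
  have hY : X ≤ max X n := le_max_left _ _
  rw [← Ioc_union_Ioi_eq_Ioi hY]
  refine (hloc _ hY).union ?_
  refine Integrable.mono' ((integrableOn_Ioi_rpow_of_lt
    (show -(s₁.re + s₃.re) < -1 by linarith) (hX.trans_le hY)).const_mul (2 ^ |s₃.re|)) ?_ ?_
  · exact ((continuousOn_avKern s₁ s₃ hn).mono
      fun x hx => hX.trans_le (hY.trans (le_of_lt hx))).aestronglyMeasurable measurableSet_Ioi
  · refine (ae_restrict_iff' measurableSet_Ioi).2 (ae_of_all _ fun x hx => ?_)
    have hx : max X n < x := hx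
    exact norm_avKern_le _ _ hn ((le_max_right _ _).trans hx.le) (hX.trans (hY.trans_lt hx))

lemma norm_integral_avKern_le {s₁ s₃ : ℂ} {n X : ℝ} (hn : 0 ≤ n) (hX : 0 < X) (hnX : n ≤ X)
    (hs : 1 < s₁.re + s₃.re) : ‖∫ u in Ioi X, avKern s₁ s₃ n u‖ ≤
      2 ^ |s₃.re| * (X ^ (1 - (s₁.re + s₃.re)) / (s₁.re + s₃.re - 1)) := by
  have h := norm_integral_le_of_norm_le (μ := volume.restrict (Ioi X))
    (f := avKern s₁ s₃ n) ((integrableOn_Ioi_rpow_of_lt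
    (show -(s₁.re + s₃.re) < -1 by linarith) hX).const_mul (2 ^ |s₃.re|))
    ((ae_restrict_iff' measurableSet_Ioi).2 (ae_of_all _ fun x (hx : X < x) =>
      norm_avKern_le s₁ s₃ hn (hnX.trans hx.le) (hX.trans hx)))
  refine h.trans_eq ?_
  rw [integral_const_mul, integral_Ioi_rpow_of_lt (by linarith) hX, neg_div, ← div_neg,
    show -(s₁.re + s₃.re) + 1 = 1 - (s₁.re + s₃.re) by ring, neg_sub]

lemma avTail_sub_avTail {s₁ s₃ : ℂ} {n X Y : ℝ} (hn : 0 ≤ n) (hX : 0 < X) (hXY : X ≤ Y)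
    (hs : 0 < s₁.re + s₃.re) (hne : s₁ + s₃ ≠ 1) :
    avTail s₁ s₃ n X - avTail s₁ s₃ n Y = ∫ u in X..Y, avKern s₁ s₃ n u := by
  have hne' : s₁ + s₃ - 1 ≠ 0 := sub_ne_zero.2 hne
  have hpos : ∀ u ∈ uIcc X Y, 0 < u := fun u hu => by
    rw [uIcc_of_le hXY] at hu
    exact hX.trans_le hu.1
  have hii : ∀ a b : ℂ, IntervalIntegrable (avKern a b n) volume X Y := fun a b =>
    ((continuousOn_avKern a b hn).mono hpos).intervalIntegrable
  have hs' : 1 < s₁.re + (s₃ + 1).re := by simp; linarith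
  have h1 : (∫ u in Ioi X, avKern s₁ (s₃ + 1) n u) - ∫ u in Ioi Y, avKern s₁ (s₃ + 1) n u =
      ∫ u in X..Y, avKern s₁ (s₃ + 1) n u := by
    have := intervalIntegral.integral_interval_add_Ioi
      (integrableOn_avKern (s₁ := s₁) (s₃ := s₃ + 1) hn hX hs')
      (integrableOn_avKern (s₁ := s₁) (s₃ := s₃ + 1) hn (hX.trans_le hXY) hs')
    rw [← this]; ring
  -- Writing u = (u + n) - n in the derivative of u^{1-s₁} (u+n)^{-s₃} leaves the kernel itself and
  -- the kernel with s₃ + 1, whose integral to infinity already converges for σ₁ + σ₃ > 0.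
  have h2 : ∫ u in X..Y, ((1 - s₁ - s₃) * avKern s₁ s₃ n u +
      s₃ * n * avKern s₁ (s₃ + 1) n u) = avKern (s₁ - 1) s₃ n Y - avKern (s₁ - 1) s₃ n X := by
    refine intervalIntegral.integral_eq_sub_of_hasDerivAt (fun u hu => ?_)
      (((hii _ _).const_mul _).add ((hii _ _).const_mul _))
    convert! hasDerivAt_avKern (s₁ - 1) s₃ hn (hpos u hu) using 1
    rw [sub_add_cancel, avKern_sub_one_left _ _ (hpos u hu), avKern_eq_add_mul s₁ s₃ hn (hpos u hu)]
    ring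
  rw [intervalIntegral.integral_add ((hii _ _).const_mul _) ((hii _ _).const_mul _),
    intervalIntegral.integral_const_mul, intervalIntegral.integral_const_mul, ← h1] at h2
  rw [avTail, avTail, ← sub_div, div_eq_iff hne']
  linear_combination h2

lemma avStep_eq_integral {s₁ s₃ : ℂ} {n x : ℝ} (hn : 0 ≤ n) (hx : 0 < x)
    (hs : 0 < s₁.re + s₃.re) (hne : s₁ + s₃ ≠ 1) :
    avStep s₁ s₃ n x = ∫ u in (0 : ℝ)..1, (avKern s₁ s₃ n x - avKern s₁ s₃ n (x + u)) := by
  have hii : IntervalIntegrable (fun u => avKern s₁ s₃ n (x + u)) volume 0 1 := by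
    refine ((continuousOn_avKern s₁ s₃ hn).comp (by fun_prop) fun u hu => ?_).intervalIntegrable
    rw [uIcc_of_le zero_le_one] at hu
    exact add_pos_of_pos_of_nonneg hx hu.1
  rw [avStep, avTail_sub_avTail hn hx (by linarith) hs hne,
    intervalIntegral.integral_sub (by simp) hii,
    intervalIntegral.integral_comp_add_left (fun u => avKern s₁ s₃ n u)]
  simp

/-- Differentiating the kernel gains 1/x at the cost of a factor ‖s₁‖ + ‖s₃‖. This is enough for
convergence on the whole domain, but loses a factor t₃ in the error term. -/
lemma norm_avStep_le {s₁ s₃ : ℂ} {n x : ℝ} (hn : 0 ≤ n) (hnx : n ≤ x) (hx : 0 < x)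
    (hs : 0 < s₁.re + s₃.re) (hne : s₁ + s₃ ≠ 1) :
    ‖avStep s₁ s₃ n x‖ ≤
      (‖s₁‖ + ‖s₃‖) * 2 ^ (|s₃.re| + 1) * x ^ (-(s₁.re + s₃.re) - 1) := by
  set K := (‖s₁‖ + ‖s₃‖) * 2 ^ (|s₃.re| + 1) * x ^ (-(s₁.re + s₃.re) - 1) with hK
  have hder : ∀ y, x ≤ y →
      ‖-s₁ * avKern (s₁ + 1) s₃ n y - s₃ * avKern s₁ (s₃ + 1) n y‖ ≤ K := by
    intro y hy
    have hy0 : 0 < y := hx.trans_le hy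
    have hyx : y ^ (-(s₁.re + s₃.re) - 1) ≤ x ^ (-(s₁.re + s₃.re) - 1) :=
      Real.rpow_le_rpow_of_nonpos hx hy (by linarith)
    have h1 := norm_avKern_le (s₁ + 1) s₃ hn (hnx.trans hy) hy0
    have h3 := norm_avKern_le s₁ (s₃ + 1) hn (hnx.trans hy) hy0
    have e1 : (2 : ℝ) ^ |s₃.re| ≤ 2 ^ (|s₃.re| + 1) :=
      Real.rpow_le_rpow_of_exponent_le (by norm_num) (by linarith)
    have e3 : (2 : ℝ) ^ |(s₃ + 1).re| ≤ 2 ^ (|s₃.re| + 1) := by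
      refine Real.rpow_le_rpow_of_exponent_le (by norm_num) ?_
      simpa using abs_add_le s₃.re 1
    have k1 : ‖avKern (s₁ + 1) s₃ n y‖ ≤ 2 ^ (|s₃.re| + 1) * x ^ (-(s₁.re + s₃.re) - 1) := by
      refine h1.trans (mul_le_mul e1 ?_ (by positivity) (by positivity))
      rw [show -((s₁ + 1).re + s₃.re) = -(s₁.re + s₃.re) - 1 by simp; ring]
      exact hyx
    have k3 : ‖avKern s₁ (s₃ + 1) n y‖ ≤ 2 ^ (|s₃.re| + 1) * x ^ (-(s₁.re + s₃.re) - 1) := by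
      refine h3.trans (mul_le_mul e3 ?_ (by positivity) (by positivity))
      rw [show -(s₁.re + (s₃ + 1).re) = -(s₁.re + s₃.re) - 1 by simp; ring]
      exact hyx
    calc _ ≤ ‖-s₁ * avKern (s₁ + 1) s₃ n y‖ + ‖s₃ * avKern s₁ (s₃ + 1) n y‖ := norm_sub_le _ _
      _ = ‖s₁‖ * ‖avKern (s₁ + 1) s₃ n y‖ + ‖s₃‖ * ‖avKern s₁ (s₃ + 1) n y‖ := by
        rw [norm_mul, norm_mul, norm_neg]
      _ ≤ ‖s₁‖ * (2 ^ (|s₃.re| + 1) * x ^ (-(s₁.re + s₃.re) - 1)) +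
          ‖s₃‖ * (2 ^ (|s₃.re| + 1) * x ^ (-(s₁.re + s₃.re) - 1)) := by gcongr
      _ = K := by rw [hK]; ring
  have hK0 : 0 ≤ K := by positivity
  rw [avStep_eq_integral hn hx hs hne]
  have := intervalIntegral.norm_integral_le_of_norm_le_const (a := 0) (b := 1) (C := K)
    (f := fun u => avKern s₁ s₃ n x - avKern s₁ s₃ n (x + u)) fun u hu => by
      rw [uIoc_of_le zero_le_one] at hu
      have hmv := (convex_Ici x).norm_image_sub_le_of_norm_hasDerivWithin_le
        (f := avKern s₁ s₃ n) (C := K)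
        (fun y hy => (hasDerivAt_avKern s₁ s₃ hn (hx.trans_le hy)).hasDerivWithinAt)
        (fun y hy => hder y hy) (x := x + u) (y := x) (mem_Ici.2 (by linarith [hu.1]))
        (mem_Ici.2 le_rfl)
      refine hmv.trans ?_
      rw [sub_add_cancel_left, norm_neg, Real.norm_of_nonneg hu.1.le]
      exact mul_le_of_le_one_right hK0 hu.2
  simpa using this

lemma avKern_mul {s₁ s₃ : ℂ} {n c x : ℝ} (hn : 0 ≤ n) (hc : 0 ≤ c) (hx : 0 ≤ x) :
    avKern s₁ s₃ (c * n) (c * x) = (c : ℂ) ^ (-s₁) * (c : ℂ) ^ (-s₃) * avKern s₁ s₃ n x := by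
  rw [avKern, avKern, ← mul_add, Complex.ofReal_mul c x, Complex.ofReal_mul c (x + n),
    Complex.mul_cpow_ofReal_nonneg hc hx, Complex.mul_cpow_ofReal_nonneg hc (by positivity)]
  ring

/-- Homogeneity of degree 1 - s₁ - s₃ under joint scaling of `n` and `x`. It turns the sum over `n`
of the tails starting at X = n into a zeta value. -/
lemma avTail_mul {s₁ s₃ : ℂ} {n c x : ℝ} (hn : 0 ≤ n) (hc : 0 < c) (hx : 0 ≤ x) :
    avTail s₁ s₃ (c * n) (c * x) = (c : ℂ) ^ (1 - s₁ - s₃) * avTail s₁ s₃ n x := by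
  have hc' : (c : ℂ) ≠ 0 := by exact_mod_cast hc.ne'
  have hint : ∫ u in Ioi (c * x), avKern s₁ (s₃ + 1) (c * n) u =
      (c : ℂ) * ((c : ℂ) ^ (-s₁) * (c : ℂ) ^ (-(s₃ + 1)) *
        ∫ u in Ioi x, avKern s₁ (s₃ + 1) n u) := by
    have h := integral_comp_mul_left_Ioi (avKern s₁ (s₃ + 1) (c * n)) x hc
    rw [← integral_const_mul]
    rw [setIntegral_congr_fun measurableSet_Ioi (fun u (hu : x < u) =>
      avKern_mul (s₁ := s₁) (s₃ := s₃ + 1) hn hc.le (hx.trans hu.le))] at h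
    rw [h, Complex.real_smul, Complex.ofReal_inv, mul_inv_cancel_left₀ hc']
  rw [avTail, avTail, hint, avKern_mul hn hc.le hx]
  rw [show -(s₃ + 1) = -s₃ - 1 by ring, show -(s₁ - 1) = -s₁ + 1 by ring,
    show 1 - s₁ - s₃ = -s₁ + 1 + -s₃ by ring, Complex.cpow_sub _ _ hc',
    Complex.cpow_add (-s₁ + 1) _ hc', Complex.cpow_add _ _ hc', Complex.cpow_one]
  push_cast
  field_simp

lemma tendsto_avTail {s₁ s₃ : ℂ} {n : ℝ} (hn : 0 ≤ n) (hs : 1 < s₁.re + s₃.re) :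
    Tendsto (avTail s₁ s₃ n) atTop (𝓝 0) := by
  have hlim : ∀ a : ℝ, 0 < a → Tendsto (fun X : ℝ => X ^ (-a)) atTop (𝓝 0) :=
    fun a ha => tendsto_rpow_neg_atTop ha
  have h1 : Tendsto (fun X => avKern (s₁ - 1) s₃ n X) atTop (𝓝 0) := by
    have hl := (hlim (s₁.re + s₃.re - 1) (by linarith)).const_mul (2 ^ |s₃.re|)
    rw [mul_zero] at hl
    refine squeeze_zero_norm' ?_ hl
    filter_upwards [eventually_gt_atTop 0, eventually_ge_atTop n] with X hX hnX
    have := norm_avKern_le (s₁ - 1) s₃ hn hnX hX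
    rwa [show -((s₁ - 1).re + s₃.re) = -(s₁.re + s₃.re - 1) by simp; ring] at this
  have h2 : Tendsto (fun X => ∫ u in Ioi X, avKern s₁ (s₃ + 1) n u) atTop (𝓝 0) := by
    have hl := ((hlim (s₁.re + s₃.re) (by linarith)).div_const
      (s₁.re + (s₃ + 1).re - 1)).const_mul (2 ^ |(s₃ + 1).re|)
    rw [zero_div, mul_zero] at hl
    refine squeeze_zero_norm' ?_ hl
    filter_upwards [eventually_gt_atTop 0, eventually_ge_atTop n] with X hX hnX
    have := norm_integral_avKern_le (s₁ := s₁) (s₃ := s₃ + 1) hn hX hnX (by simp; linarith)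
    rwa [show 1 - (s₁.re + (s₃ + 1).re) = -(s₁.re + s₃.re) by simp; ring] at this
  have := (h1.add (h2.const_mul (s₃ * n))).div_const (s₁ + s₃ - 1)
  rw [mul_zero, add_zero, zero_div] at this
  exact this

/-! ### Holomorphy of sums and integrals from local bounds -/

section Holomorphy

variable {E : Type*} [NormedAddCommGroup E] [NormedSpace ℂ E]

/-- Cauchy's estimate on the ball of radius r about `y`, where f varies by at most 2M from f(y).
With it, domination of the functions alone suffices for differentiating series and integrals. -/
lemma norm_fderiv_le_of_norm_le_on_ball {f : E → ℂ} {x y : E} {r M : ℝ} (hr : 0 < r)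
    (hf : DifferentiableOn ℂ f (Metric.ball x (2 * r)))
    (hM : ∀ z ∈ Metric.ball x (2 * r), ‖f z‖ ≤ M) (hy : y ∈ Metric.ball x r) :
    ‖fderiv ℂ f y‖ ≤ 2 * M / r := by
  have hsub : Metric.ball y r ⊆ Metric.ball x (2 * r) :=
    Metric.ball_subset_ball' (by linarith [Metric.mem_ball.1 hy])
  refine Complex.norm_fderiv_le_div_of_mapsTo_ball (hf.mono hsub) (fun z hz => ?_) hr
  rw [Metric.mem_closedBall, dist_eq_norm]
  have h1 := hM z (hsub hz)
  have h2 := hM y (hsub (Metric.mem_ball_self hr))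
  linarith [norm_sub_le (f z) (f y)]

lemma differentiableAt_tsum_of_norm_le_on_ball {ι : Type*} {F : ι → E → ℂ} {u : ι → ℝ} {x : E}
    {r : ℝ} (hr : 0 < r) (hu : Summable u)
    (hF : ∀ i, DifferentiableOn ℂ (F i) (Metric.ball x r))
    (hb : ∀ i, ∀ y ∈ Metric.ball x r, ‖F i y‖ ≤ u i) :
    DifferentiableAt ℂ (fun y => ∑' i, F i y) x := by
  -- The real structure serves only the convexity, hence connectedness, of the ball.
  let _ : NormedSpace ℝ E := NormedSpace.restrictScalars ℝ ℂ E
  have hr2 : 0 < r / 2 := by linarith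
  have e : 2 * (r / 2) = r := by ring
  have hx : x ∈ Metric.ball x (r / 2) := Metric.mem_ball_self hr2
  refine (hasFDerivAt_tsum_of_isPreconnected (𝕜 := ℂ) (f' := fun i y => fderiv ℂ (F i) y)
    ((hu.mul_left 2).div_const (r / 2)) Metric.isOpen_ball
    (convex_ball x (r / 2)).isPreconnected (fun i y hy => ?_) (fun i y hy => ?_) hx ?_
    hx).differentiableAt
  · exact ((hF i).differentiableAt (Metric.isOpen_ball.mem_nhds
      (Metric.ball_subset_ball (by linarith) hy))).hasFDerivAt
  · exact norm_fderiv_le_of_norm_le_on_ball hr2 (by rw [e]; exact hF i)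
      (by rw [e]; exact hb i) hy
  · exact Summable.of_norm_bounded hu fun i => hb i x (Metric.mem_ball_self hr)

lemma differentiableAt_integral_of_norm_le_on_ball {α : Type*} [MeasurableSpace α]
    {μ : Measure α} {F : E → α → ℂ} {b : α → ℝ} {x : E} {r : ℝ} (hr : 0 < r)
    (hb : Integrable b μ)
    (hF : ∀ᵐ a ∂μ, DifferentiableOn ℂ (fun y => F y a) (Metric.ball x r))
    (hFb : ∀ᵐ a ∂μ, ∀ y ∈ Metric.ball x r, ‖F y a‖ ≤ b a)
    (hm : ∀ y ∈ Metric.ball x r, AEStronglyMeasurable (F y) μ)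
    (hm' : AEStronglyMeasurable (fun a => fderiv ℂ (fun y => F y a) x) μ) :
    DifferentiableAt ℂ (fun y => ∫ a, F y a ∂μ) x := by
  have hr2 : 0 < r / 2 := by linarith
  have e : 2 * (r / 2) = r := by ring
  have hx : x ∈ Metric.ball x r := Metric.mem_ball_self hr
  refine (hasFDerivAt_integral_of_dominated_of_fderiv_le (𝕜 := ℂ)
    (F' := fun y a => fderiv ℂ (fun y => F y a) y) (bound := fun a => 2 * b a / (r / 2))
    (Metric.ball_mem_nhds x hr2) ?_ ?_ hm' ?_ ((hb.const_mul 2).div_const _) ?_).differentiableAt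
  · filter_upwards [Metric.ball_mem_nhds x hr] with y hy using hm y hy
  · exact hb.mono' (hm x hx) (hFb.mono fun a ha => ha x hx)
  · filter_upwards [hF, hFb] with a h1 h2 y hy
    exact norm_fderiv_le_of_norm_le_on_ball hr2 (by rw [e]; exact h1) (by rw [e]; exact h2) hy
  · filter_upwards [hF] with a h1 y hy
    exact (h1.differentiableAt (Metric.isOpen_ball.mem_nhds
      (Metric.ball_subset_ball (by linarith) hy))).hasFDerivAt

end Holomorphy

/-! ### Holomorphy of kernel, tails and differences -/

/-- The explicit derivative shows its measurability in `u`, which differentiation under the integral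
sign requires. -/
lemma hasFDerivAt_avKern {n u : ℝ} (hn : 0 ≤ n) (hu : 0 < u) (s : ℂ × ℂ) :
    HasFDerivAt (fun s : ℂ × ℂ => avKern s.1 s.2 n u)
      ((-(avKern s.1 s.2 n u * Complex.log u)) • ContinuousLinearMap.fst ℂ ℂ ℂ +
        (-(avKern s.1 s.2 n u * Complex.log (u + n : ℝ))) • ContinuousLinearMap.snd ℂ ℂ ℂ) s := by
  have hu' : (u : ℂ) ≠ 0 := by exact_mod_cast hu.ne'
  have hun : ((u + n : ℝ) : ℂ) ≠ 0 := by exact_mod_cast (by positivity : 0 < u + n).ne'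
  have h1 := HasFDerivAt.const_cpow (f := fun t : ℂ × ℂ => -t.1) (c := (u : ℂ))
    (hasFDerivAt_fst (𝕜 := ℂ) (p := s)).neg (Or.inl hu')
  have h2 := HasFDerivAt.const_cpow (f := fun t : ℂ × ℂ => -t.2) (c := ((u + n : ℝ) : ℂ))
    (hasFDerivAt_snd (𝕜 := ℂ) (p := s)).neg (Or.inl hun)
  refine (h1.mul h2).congr_fderiv ?_
  simp only [avKern]
  module

lemma differentiable_avKern {n u : ℝ} (hn : 0 ≤ n) (hu : 0 < u) :
    Differentiable ℂ (fun s : ℂ × ℂ => avKern s.1 s.2 n u) := fun s =>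
  (hasFDerivAt_avKern hn hu s).differentiableAt

lemma measurable_avKern (s₁ s₃ : ℂ) (n : ℝ) : Measurable (avKern s₁ s₃ n) := by
  unfold avKern
  fun_prop

lemma abs_re_sub_re_lt {s t : ℂ × ℂ} {r : ℝ} (h : t ∈ Metric.ball s r) :
    |t.1.re - s.1.re| < r ∧ |t.2.re - s.2.re| < r := by
  rw [Metric.mem_ball, dist_eq_norm] at h
  constructor
  · rw [← Complex.sub_re]
    exact ((Complex.abs_re_le_norm _).trans (norm_fst_le (t - s))).trans_lt h
  · rw [← Complex.sub_re]
    exact ((Complex.abs_re_le_norm _).trans (norm_snd_le (t - s))).trans_lt h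

lemma differentiableAt_integral_avKern {n X : ℝ} (hn : 0 ≤ n) (hnX : n ≤ X) (hX : 1 ≤ X)
    {s : ℂ × ℂ} (hs : 1 < s.1.re + s.2.re) :
    DifferentiableAt ℂ (fun s : ℂ × ℂ => ∫ u in Ioi X, avKern s.1 s.2 n u) s := by
  set ε := s.1.re + s.2.re - 1 with hε
  have hε0 : 0 < ε := by linarith
  -- Each real part moves by less than ε/4, so σ₁ + σ₃ stays above 1 + ε/2 on the ball; u ≥ 1 makes
  -- the powers monotone in the exponent.
  refine differentiableAt_integral_of_norm_le_on_ball (r := ε / 4) (by linarith)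
    (b := fun u => 2 ^ (|s.2.re| + ε / 4) * u ^ (-1 - ε / 2)) ?_ ?_ ?_ ?_ ?_
  · exact (integrableOn_Ioi_rpow_of_lt (by linarith) (by linarith)).const_mul _
  · refine (ae_restrict_iff' measurableSet_Ioi).2 (ae_of_all _ fun u (hu : X < u) => ?_)
    exact (differentiable_avKern hn (by linarith)).differentiableOn
  · refine (ae_restrict_iff' measurableSet_Ioi).2 (ae_of_all _ fun u (hu : X < u) t ht => ?_)
    obtain ⟨h1, h2⟩ := abs_re_sub_re_lt ht
    refine (norm_avKern_le t.1 t.2 hn (hnX.trans hu.le) (by linarith)).trans ?_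
    refine mul_le_mul (Real.rpow_le_rpow_of_exponent_le (by norm_num) ?_)
      (Real.rpow_le_rpow_of_exponent_le (by linarith) ?_) (Real.rpow_nonneg (by linarith) _)
      (by positivity)
    · linarith [abs_sub_abs_le_abs_sub t.2.re s.2.re]
    · linarith [(abs_lt.1 h1).1, (abs_lt.1 h2).1]
  · exact fun t _ => (measurable_avKern _ _ _).aestronglyMeasurable
  · have hmeas : AEStronglyMeasurable (fun u : ℝ =>
        (-(avKern s.1 s.2 n u * Complex.log u)) • ContinuousLinearMap.fst ℂ ℂ ℂ +
        (-(avKern s.1 s.2 n u * Complex.log (u + n : ℝ))) • ContinuousLinearMap.snd ℂ ℂ ℂ)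
        (volume.restrict (Ioi X)) := by
      have hk := measurable_avKern s.1 s.2 n
      refine AEStronglyMeasurable.add ?_ ?_
      · exact (Measurable.aestronglyMeasurable (by fun_prop)).smul_const _
      · exact (Measurable.aestronglyMeasurable (by fun_prop)).smul_const _
    refine hmeas.congr ((ae_restrict_iff' measurableSet_Ioi).2 (ae_of_all _ fun u hu => ?_))
    have hu : X < u := hu
    exact (hasFDerivAt_avKern hn (by linarith) s).fderiv.symm

lemma differentiableAt_avTail {n X : ℝ} (hn : 0 ≤ n) (hnX : n ≤ X) (hX : 1 ≤ X)
    {s : ℂ × ℂ} (hs : 0 < s.1.re + s.2.re) (hne : s.1 + s.2 ≠ 1) :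
    DifferentiableAt ℂ (fun s : ℂ × ℂ => avTail s.1 s.2 n X) s := by
  have h1 : DifferentiableAt ℂ (fun s : ℂ × ℂ => avKern (s.1 - 1) s.2 n X) s :=
    (differentiable_avKern hn (by linarith) (s.1 - 1, s.2)).comp s
      (f := fun s : ℂ × ℂ => (s.1 - 1, s.2)) (by fun_prop)
  have h2 : DifferentiableAt ℂ (fun s : ℂ × ℂ => ∫ u in Ioi X, avKern s.1 (s.2 + 1) n u) s :=
    (differentiableAt_integral_avKern hn hnX hX
      (s := (s.1, s.2 + 1)) (by simp; linarith)).comp s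
      (f := fun s : ℂ × ℂ => (s.1, s.2 + 1)) (by fun_prop)
  have h3 : s.1 + s.2 - 1 ≠ 0 := sub_ne_zero.2 hne
  unfold avTail
  fun_prop (disch := assumption)

lemma differentiableAt_avStep {n X : ℝ} (hn : 0 ≤ n) (hnX : n ≤ X) (hX : 1 ≤ X)
    {s : ℂ × ℂ} (hs : 0 < s.1.re + s.2.re) (hne : s.1 + s.2 ≠ 1) :
    DifferentiableAt ℂ (fun s : ℂ × ℂ => avStep s.1 s.2 n X) s :=
  (differentiable_avKern hn (by linarith) s).sub ((differentiableAt_avTail hn hnX hX hs hne).sub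
    (differentiableAt_avTail hn (by linarith) (by linarith) hs hne))

/-! ### Sums of negative powers -/

/-- Telescoping form of the integral comparison. It follows from exp y ≥ 1 + y and log(1 + 1/x) ≥
1/(x+1), which work for every τ > 0. -/
lemma rpow_neg_sub_one_le_sub_div {τ x : ℝ} (hτ : 0 < τ) (hx : 0 < x) :
    (x + 1) ^ (-τ - 1) ≤ (x ^ (-τ) - (x + 1) ^ (-τ)) / τ := by
  have hy : 0 < x + 1 := by linarith
  have h1 : x ^ (-τ) = (x + 1) ^ (-τ) * ((x + 1) / x) ^ τ := by
    rw [Real.div_rpow hy.le hx.le, Real.rpow_neg hy.le, Real.rpow_neg hx.le]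
    have := (Real.rpow_pos_of_pos hy τ).ne'
    field_simp
  have h2 : 1 + τ / (x + 1) ≤ ((x + 1) / x) ^ τ := by
    have h3 : 1 / (x + 1) ≤ Real.log ((x + 1) / x) := by
      have := Real.one_sub_inv_le_log_of_pos (show 0 < (x + 1) / x by positivity)
      refine le_trans (le_of_eq ?_) this
      field_simp
      ring
    rw [Real.rpow_def_of_pos (by positivity)]
    have h4 := Real.add_one_le_exp (Real.log ((x + 1) / x) * τ)
    have h5 := mul_le_mul_of_nonneg_right h3 hτ.le
    have h6 : 1 / (x + 1) * τ = τ / (x + 1) := by ring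
    linarith
  rw [le_div_iff₀ hτ, h1, Real.rpow_sub_one hy.ne']
  have := mul_le_mul_of_nonneg_left h2 (Real.rpow_nonneg hy.le (-τ))
  have h7 : (x + 1) ^ (-τ) / (x + 1) * τ = (x + 1) ^ (-τ) * (τ / (x + 1)) := by ring
  linarith

lemma sum_range_rpow_succ_le {τ x : ℝ} (hτ : 0 < τ) (hx : 0 < x) (K : ℕ) :
    ∑ k ∈ Finset.range K, (x + k + 1) ^ (-τ - 1) ≤ x ^ (-τ) / τ := by
  have : ∑ k ∈ Finset.range K, (x + k + 1) ^ (-τ - 1) ≤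
      (x ^ (-τ) - (x + K) ^ (-τ)) / τ := by
    induction K with
    | zero => simp
    | succ K ih =>
      rw [Finset.sum_range_succ]
      have := rpow_neg_sub_one_le_sub_div hτ (show 0 < x + K by positivity)
      push_cast
      rw [← add_assoc]
      rw [sub_div] at *
      linarith
  refine this.trans (div_le_div_of_nonneg_right ?_ hτ.le)
  linarith [Real.rpow_nonneg (show 0 ≤ x + K by positivity) (-τ)]

lemma sum_range_rpow_le {τ x : ℝ} (hτ : 0 < τ) (hx : 1 ≤ x) (K : ℕ) :
    ∑ k ∈ Finset.range K, (x + k) ^ (-τ - 1) ≤ (1 + 1 / τ) * x ^ (-τ) := by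
  have hx0 : 0 < x := by linarith
  have h := sum_range_rpow_succ_le hτ hx0 K
  have h1 : ∑ k ∈ Finset.range K, (x + k) ^ (-τ - 1) ≤
      ∑ k ∈ Finset.range (K + 1), (x + k) ^ (-τ - 1) :=
    Finset.sum_le_sum_of_subset_of_nonneg (Finset.range_mono (by omega))
      fun i _ _ => Real.rpow_nonneg (by positivity) _
  rw [Finset.sum_range_succ'] at h1
  have h2 : x ^ (-τ - 1) ≤ x ^ (-τ) := Real.rpow_le_rpow_of_exponent_le hx (by linarith)
  push_cast at h1
  rw [add_zero] at h1
  simp only [← add_assoc] at h1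
  calc _ ≤ _ := h1
    _ ≤ x ^ (-τ) / τ + x ^ (-τ) := by linarith
    _ = _ := by ring

lemma summable_add_nat_rpow {τ x : ℝ} (hτ : 0 < τ) (hx : 1 ≤ x) :
    Summable (fun k : ℕ => (x + k) ^ (-τ - 1)) :=
  summable_of_sum_range_le (fun _ => Real.rpow_nonneg (by positivity) _)
    (sum_range_rpow_le hτ hx)

lemma tsum_add_nat_rpow_le {τ x : ℝ} (hτ : 0 < τ) (hx : 1 ≤ x) :
    ∑' k : ℕ, (x + k) ^ (-τ - 1) ≤ (1 + 1 / τ) * x ^ (-τ) :=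
  Real.tsum_le_of_sum_range_le (fun _ => Real.rpow_nonneg (by positivity) _)
    (sum_range_rpow_le hτ hx)

/-- The inner sum over `k` is O(n^{-τ}), which leaves the sum of n^{-α-τ}. For τ = σ₁ + σ₃ and α =
σ₂ the two hypotheses are the half-space conditions of the domain. -/
lemma summable_rpow_mul_rpow {α τ : ℝ} (hτ : 0 < τ) (hα : 1 < α + τ) :
    Summable (fun p : ℕ × ℕ => ((p.1 : ℝ) + 1) ^ (-α) * ((p.1 : ℝ) + 1 + p.2) ^ (-τ - 1)) := by
  have h1 : ∀ n : ℕ, (1 : ℝ) ≤ (n : ℝ) + 1 := fun n => by linarith [n.cast_nonneg (α := ℝ)]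
  have h0 : ∀ p : ℕ × ℕ,
      0 ≤ ((p.1 : ℝ) + 1) ^ (-α) * ((p.1 : ℝ) + 1 + p.2) ^ (-τ - 1) := fun p => by positivity
  have hs : Summable fun k : ℕ => (1 + 1 / τ) * (1 + (k : ℝ)) ^ (-(α + τ - 1) - 1) :=
    (summable_add_nat_rpow (τ := α + τ - 1) (by linarith) le_rfl).mul_left _
  have hin : ∀ n : ℕ, Summable fun k : ℕ =>
      ((n : ℝ) + 1) ^ (-α) * ((n : ℝ) + 1 + k) ^ (-τ - 1) :=
    fun n => (summable_add_nat_rpow hτ (h1 n)).mul_left _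
  have hle : ∀ n : ℕ, ∑' k : ℕ, ((n : ℝ) + 1) ^ (-α) * ((n : ℝ) + 1 + k) ^ (-τ - 1) ≤
      (1 + 1 / τ) * (1 + (n : ℝ)) ^ (-(α + τ - 1) - 1) := by
    intro n
    rw [tsum_mul_left]
    calc _ ≤ ((n : ℝ) + 1) ^ (-α) * ((1 + 1 / τ) * ((n : ℝ) + 1) ^ (-τ)) :=
          mul_le_mul_of_nonneg_left (tsum_add_nat_rpow_le hτ (h1 n)) (by positivity)
      _ = (1 + 1 / τ) * (((n : ℝ) + 1) ^ (-α) * ((n : ℝ) + 1) ^ (-τ)) := by ring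
      _ = (1 + 1 / τ) * (1 + (n : ℝ)) ^ (-(α + τ - 1) - 1) := by
        rw [← Real.rpow_add (by positivity), add_comm (n : ℝ) 1]
        ring_nf
  have hout : Summable fun n : ℕ =>
      ∑' k : ℕ, ((n : ℝ) + 1) ^ (-α) * ((n : ℝ) + 1 + k) ^ (-τ - 1) :=
    Summable.of_nonneg_of_le (fun n => tsum_nonneg fun k => h0 (n, k)) hle hs
  exact (summable_prod_of_nonneg h0).2 ⟨hin, hout⟩

/-! ### An explicit continuation and its holomorphy -/

/-- The general term of the double series of differences in the continuation: here `n = p.1 + 1`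
and `m = p.1 + 1 + p.2`. -/
noncomputable def avTerm (s₁ s₂ s₃ : ℂ) (p : ℕ × ℕ) : ℂ :=
  (((p.1 : ℝ) + 1 : ℝ) : ℂ) ^ (-s₂) * avStep s₁ s₃ ((p.1 : ℝ) + 1) ((p.1 : ℝ) + 1 + p.2)

/-- The continuation of `∑ n^{-w}` to `Re w > 0`. -/
noncomputable def zetaCont (w : ℂ) : ℂ :=
  avTail w 0 0 1 + ∑' k : ℕ, avStep w 0 0 (1 + k)

/-- An explicit continuation of the Apostol-Vu series. -/
noncomputable def avCont (s₁ s₂ s₃ : ℂ) : ℂ :=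
  avTail s₁ s₃ 1 1 * zetaCont (s₁ + s₂ + s₃ - 1) - 2 ^ (-s₃) * riemannZeta (s₁ + s₂ + s₃) +
    ∑' p : ℕ × ℕ, avTerm s₁ s₂ s₃ p

lemma isOpen_avDomain : IsOpen avDomain := by
  have c1 : Continuous fun s : ℂ × ℂ × ℂ => s.1.re + s.2.2.re := by fun_prop
  have c2 : Continuous fun s : ℂ × ℂ × ℂ => s.1.re + s.2.1.re + s.2.2.re := by fun_prop
  have c3 : Continuous fun s : ℂ × ℂ × ℂ => s.1 + s.2.2 := by fun_prop
  have c4 : Continuous fun s : ℂ × ℂ × ℂ => s.1 + s.2.1 + s.2.2 := by fun_prop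
  exact (isOpen_lt continuous_const c1).inter ((isOpen_lt continuous_const c2).inter
    ((isOpen_ne_fun c3 continuous_const).inter (isOpen_ne_fun c4 continuous_const)))

lemma norm_avTerm_le {s₁ s₂ s₃ : ℂ} (hs : 0 < s₁.re + s₃.re) (hne : s₁ + s₃ ≠ 1) (p : ℕ × ℕ) :
    ‖avTerm s₁ s₂ s₃ p‖ ≤ (‖s₁‖ + ‖s₃‖) * 2 ^ (|s₃.re| + 1) *
      (((p.1 : ℝ) + 1) ^ (-s₂.re) * ((p.1 : ℝ) + 1 + p.2) ^ (-(s₁.re + s₃.re) - 1)) := by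
  have hn : (0 : ℝ) < (p.1 : ℝ) + 1 := by positivity
  rw [avTerm, norm_mul, Complex.norm_cpow_eq_rpow_re_of_pos hn, Complex.neg_re]
  have := mul_le_mul_of_nonneg_left (norm_avStep_le (s₁ := s₁) (s₃ := s₃) hn.le
    (show (p.1 : ℝ) + 1 ≤ (p.1 : ℝ) + 1 + p.2 by linarith [p.2.cast_nonneg (α := ℝ)])
    (by positivity) hs hne) (Real.rpow_nonneg hn.le (-s₂.re))
  refine this.trans_eq ?_
  ring

lemma summable_avTerm {s₁ s₂ s₃ : ℂ} (hs : 0 < s₁.re + s₃.re)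
    (hs' : 1 < s₁.re + s₂.re + s₃.re) (hne : s₁ + s₃ ≠ 1) :
    Summable (avTerm s₁ s₂ s₃) :=
  Summable.of_norm_bounded ((summable_rpow_mul_rpow hs (by linarith)).mul_left _)
    (norm_avTerm_le hs hne)

lemma differentiableAt_avTerm {t : ℂ × ℂ × ℂ} (ht : t ∈ avDomain) (p : ℕ × ℕ) :
    DifferentiableAt ℂ (fun t : ℂ × ℂ × ℂ => avTerm t.1 t.2.1 t.2.2 p) t := by
  obtain ⟨h1, h2, h3, h4⟩ := ht
  have hn : (((p.1 : ℝ) + 1 : ℝ) : ℂ) ≠ 0 := by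
    exact_mod_cast (by positivity : (0 : ℝ) < (p.1 : ℝ) + 1).ne'
  have hst := (differentiableAt_avStep (n := (p.1 : ℝ) + 1) (X := (p.1 : ℝ) + 1 + p.2)
    (by positivity) (by linarith [p.2.cast_nonneg (α := ℝ)])
    (by linarith [p.2.cast_nonneg (α := ℝ), p.1.cast_nonneg (α := ℝ)])
    (s := (t.1, t.2.2)) h1 h3).comp t (f := fun t : ℂ × ℂ × ℂ => (t.1, t.2.2)) (by fun_prop)
  have hp : DifferentiableAt ℂ
      (fun t : ℂ × ℂ × ℂ => (((p.1 : ℝ) + 1 : ℝ) : ℂ) ^ (-t.2.1)) t :=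
    DifferentiableAt.const_cpow (by fun_prop) (Or.inl hn)
  exact hp.mul hst

lemma differentiableAt_tsum_avTerm {s : ℂ × ℂ × ℂ} (hs : s ∈ avDomain) :
    DifferentiableAt ℂ (fun s : ℂ × ℂ × ℂ => ∑' p, avTerm s.1 s.2.1 s.2.2 p) s := by
  obtain ⟨r₀, hr₀, hball⟩ := Metric.isOpen_iff.1 isOpen_avDomain s hs
  obtain ⟨h1, h2, h3, h4⟩ := hs
  set e := min (s.1.re + s.2.2.re) (s.1.re + s.2.1.re + s.2.2.re - 1) with he
  have he0 : 0 < e := lt_min h1 (by linarith)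
  have he1 : e ≤ s.1.re + s.2.2.re := min_le_left _ _
  have he2 : e ≤ s.1.re + s.2.1.re + s.2.2.re - 1 := min_le_right _ _
  -- On the ball σ₁ + σ₃ drops by at most 2r and σ₁ + σ₂ + σ₃ by at most 3r, so r ≤ e/4 keeps the
  -- majorant summable.
  set r := min r₀ (e / 4) with hr
  have hr0 : 0 < r := lt_min hr₀ (by linarith)
  have hr1 : r ≤ e / 4 := min_le_right _ _
  have hsub : Metric.ball s r ⊆ avDomain :=
    (Metric.ball_subset_ball (min_le_left _ _)).trans hball
  have hu : Summable fun p : ℕ × ℕ =>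
      (‖s.1‖ + r + (‖s.2.2‖ + r)) * 2 ^ (|s.2.2.re| + r + 1) *
      (((p.1 : ℝ) + 1) ^ (-(s.2.1.re - r)) *
        ((p.1 : ℝ) + 1 + p.2) ^ (-(s.1.re + s.2.2.re - 2 * r) - 1)) :=
    (summable_rpow_mul_rpow (by linarith) (by linarith)).mul_left _
  refine differentiableAt_tsum_of_norm_le_on_ball hr0 hu
    (fun p t ht => (differentiableAt_avTerm (hsub ht) p).differentiableWithinAt)
    (fun p t ht => ?_)
  obtain ⟨k1, k2, k3, k4⟩ := hsub ht
  have ht' : ‖t - s‖ < r := by rwa [Metric.mem_ball, dist_eq_norm] at ht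
  have d1 : ‖t.1 - s.1‖ < r := (norm_fst_le (t - s)).trans_lt ht'
  have d2 : ‖t.2.1 - s.2.1‖ < r := ((norm_fst_le (t.2 - s.2)).trans
    (norm_snd_le (t - s))).trans_lt ht'
  have d3 : ‖t.2.2 - s.2.2‖ < r := ((norm_snd_le (t.2 - s.2)).trans
    (norm_snd_le (t - s))).trans_lt ht'
  have a1 := (Complex.abs_re_le_norm _).trans_lt d1
  have a2 := (Complex.abs_re_le_norm _).trans_lt d2
  have a3 := (Complex.abs_re_le_norm _).trans_lt d3
  rw [Complex.sub_re] at a1 a2 a3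
  have hp1 := p.1.cast_nonneg (α := ℝ)
  have hp2 := p.2.cast_nonneg (α := ℝ)
  refine (norm_avTerm_le k1 k3 p).trans ?_
  gcongr
  · linarith [norm_sub_norm_le t.1 s.1]
  · linarith [norm_sub_norm_le t.2.2 s.2.2]
  · norm_num
  · linarith [abs_sub_abs_le_abs_sub t.2.2.re s.2.2.re]
  · linarith
  · linarith [(abs_lt.1 a2).1]
  · linarith
  · linarith [(abs_lt.1 a1).1, (abs_lt.1 a3).1]

lemma norm_avStep_zero_le {w : ℂ} (hw : 0 < w.re) (hw1 : w ≠ 1) {x : ℝ} (hx : 0 < x) :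
    ‖avStep w 0 0 x‖ ≤ 2 * ‖w‖ * x ^ (-w.re - 1) := by
  have := norm_avStep_le (s₁ := w) (s₃ := 0) (n := 0) le_rfl hx.le hx (by simpa using hw)
    (by simpa using hw1)
  simp only [norm_zero, add_zero, Complex.zero_re, abs_zero, zero_add, Real.rpow_one] at this
  linarith

lemma summable_avStep_zero {w : ℂ} (hw : 0 < w.re) (hw1 : w ≠ 1) {x : ℝ} (hx : 1 ≤ x) :
    Summable (fun k : ℕ => avStep w 0 0 (x + k)) :=
  Summable.of_norm_bounded ((summable_add_nat_rpow hw hx).mul_left (2 * ‖w‖))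
    fun k => norm_avStep_zero_le hw hw1 (by positivity)

lemma differentiableAt_zetaCont {w : ℂ} (hw : 0 < w.re) (hw1 : w ≠ 1) :
    DifferentiableAt ℂ zetaCont w := by
  have hopen : IsOpen {w : ℂ | 0 < w.re ∧ w ≠ 1} :=
    (isOpen_lt continuous_const Complex.continuous_re).inter isOpen_ne
  obtain ⟨r₀, hr₀, hball⟩ := Metric.isOpen_iff.1 hopen w ⟨hw, hw1⟩
  set r := min r₀ (w.re / 2) with hr
  have hr0 : 0 < r := lt_min hr₀ (by linarith)
  have hr1 : r ≤ w.re / 2 := min_le_right _ _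
  have hsub := (Metric.ball_subset_ball (x := w) (min_le_left r₀ (w.re / 2))).trans hball
  refine DifferentiableAt.add ?_ ?_
  · exact (differentiableAt_avTail (n := 0) (X := 1) le_rfl zero_le_one le_rfl (s := (w, 0))
      (by simpa using hw) (by simpa using hw1)).comp w (f := fun w : ℂ => (w, (0 : ℂ)))
      (by fun_prop)
  · refine differentiableAt_tsum_of_norm_le_on_ball hr0 (u := fun k : ℕ =>
      2 * (‖w‖ + r) * (1 + (k : ℝ)) ^ (-(w.re - r) - 1))
      ((summable_add_nat_rpow (by linarith) le_rfl).mul_left _) (fun k => ?_) (fun k z hz => ?_)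
    · intro z hz
      obtain ⟨h1, h2⟩ := hsub hz
      exact ((differentiableAt_avStep (n := 0) (X := 1 + (k : ℝ)) le_rfl (by positivity)
        (by linarith [k.cast_nonneg (α := ℝ)]) (s := (z, 0))
        (by simpa using h1) (by simpa using h2)).comp z (f := fun w : ℂ => (w, (0 : ℂ)))
        (by fun_prop)).differentiableWithinAt
    · obtain ⟨h1, h2⟩ := hsub hz
      have hz' : ‖z - w‖ < r := by rwa [Metric.mem_ball, dist_eq_norm] at hz
      have a1 := (Complex.abs_re_le_norm _).trans_lt hz'
      rw [Complex.sub_re] at a1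
      refine (norm_avStep_zero_le h1 h2 (by positivity)).trans ?_
      have hk := k.cast_nonneg (α := ℝ)
      gcongr
      · linarith [norm_sub_norm_le z w]
      · linarith
      · linarith [(abs_lt.1 a1).1]

lemma differentiableOn_avCont :
    DifferentiableOn ℂ (fun s : ℂ × ℂ × ℂ => avCont s.1 s.2.1 s.2.2) avDomain := by
  intro s hs
  refine DifferentiableAt.differentiableWithinAt ?_
  have hT := differentiableAt_tsum_avTerm hs
  obtain ⟨h1, h2, h3, h4⟩ := hs
  have hI : DifferentiableAt ℂ (fun s : ℂ × ℂ × ℂ => avTail s.1 s.2.2 1 1) s :=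
    (differentiableAt_avTail (n := 1) (X := 1) zero_le_one le_rfl le_rfl
      (s := (s.1, s.2.2)) h1 h3).comp s (f := fun t : ℂ × ℂ × ℂ => (t.1, t.2.2)) (by fun_prop)
  have hZ : DifferentiableAt ℂ (fun s : ℂ × ℂ × ℂ => zetaCont (s.1 + s.2.1 + s.2.2 - 1)) s :=
    (differentiableAt_zetaCont (w := s.1 + s.2.1 + s.2.2 - 1) (by simp; linarith)
      (fun h => h4 (by linear_combination h))).comp s
      (f := fun s : ℂ × ℂ × ℂ => s.1 + s.2.1 + s.2.2 - 1) (by fun_prop)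
  have hR : DifferentiableAt ℂ (fun s : ℂ × ℂ × ℂ => riemannZeta (s.1 + s.2.1 + s.2.2)) s := by
    refine (differentiableAt_riemannZeta (s := s.1 + s.2.1 + s.2.2) (fun h => ?_)).comp s
      (f := fun s : ℂ × ℂ × ℂ => s.1 + s.2.1 + s.2.2) (by fun_prop)
    have := congrArg Complex.re h
    simp at this
    linarith
  have h2 : DifferentiableAt ℂ (fun s : ℂ × ℂ × ℂ => (2 : ℂ) ^ (-s.2.2)) s :=
    DifferentiableAt.const_cpow (by fun_prop) (Or.inl two_ne_zero)
  exact ((hI.mul hZ).sub (h2.mul hR)).add hT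

/-! ### Agreement with the series in the region of convergence -/

lemma summable_avKern_add_nat {s₁ s₃ : ℂ} {n X : ℝ} (hn : 0 ≤ n) (hnX : n ≤ X) (hX : 1 ≤ X)
    (hs : 1 < s₁.re + s₃.re) : Summable (fun k : ℕ => avKern s₁ s₃ n (X + k)) := by
  refine Summable.of_norm_bounded ((summable_add_nat_rpow
    (τ := s₁.re + s₃.re - 1) (by linarith) hX).mul_left (2 ^ |s₃.re|)) fun k => ?_
  have hk := k.cast_nonneg (α := ℝ)
  have := norm_avKern_le s₁ s₃ hn (show n ≤ X + k by linarith) (by linarith)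
  rwa [show -(s₁.re + s₃.re) = -(s₁.re + s₃.re - 1) - 1 by ring] at this

lemma summable_avStep_add_nat {s₁ s₃ : ℂ} {n X : ℝ} (hn : 0 ≤ n) (hnX : n ≤ X) (hX : 1 ≤ X)
    (hs : 0 < s₁.re + s₃.re) (hne : s₁ + s₃ ≠ 1) :
    Summable (fun k : ℕ => avStep s₁ s₃ n (X + k)) := by
  refine Summable.of_norm_bounded ((summable_add_nat_rpow hs hX).mul_left
    ((‖s₁‖ + ‖s₃‖) * 2 ^ (|s₃.re| + 1))) fun k => ?_
  have hk := k.cast_nonneg (α := ℝ)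
  exact norm_avStep_le hn (show n ≤ X + k by linarith) (by linarith) hs hne

lemma hasSum_avTail_sub_avTail {s₁ s₃ : ℂ} {n X : ℝ} (hn : 0 ≤ n) (hnX : n ≤ X) (hX : 1 ≤ X)
    (hs : 1 < s₁.re + s₃.re) :
    HasSum (fun k : ℕ => avTail s₁ s₃ n (X + k) - avTail s₁ s₃ n (X + k + 1))
      (avTail s₁ s₃ n X) := by
  have hne : s₁ + s₃ ≠ 1 := fun h => by
    have := congrArg Complex.re h
    simp at this
    linarith
  have hsum : Summable (fun k : ℕ =>
      avTail s₁ s₃ n (X + k) - avTail s₁ s₃ n (X + k + 1)) := by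
    refine ((summable_avKern_add_nat hn hnX hX hs).sub
      (summable_avStep_add_nat hn hnX hX (by linarith) hne)).congr fun k => ?_
    rw [avStep]
    ring
  rw [hsum.hasSum_iff_tendsto_nat]
  have hpart : ∀ K : ℕ, ∑ k ∈ Finset.range K,
      (avTail s₁ s₃ n (X + k) - avTail s₁ s₃ n (X + k + 1)) =
      avTail s₁ s₃ n X - avTail s₁ s₃ n (X + K) := fun K => by
    have := Finset.sum_range_sub' (fun k : ℕ => avTail s₁ s₃ n (X + k)) K
    push_cast at this
    simpa [add_assoc] using this
  simp only [hpart]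
  have hl : Tendsto (fun K : ℕ => avTail s₁ s₃ n (X + K)) atTop (𝓝 0) :=
    (tendsto_avTail hn hs).comp
      (tendsto_atTop_add_const_left _ X tendsto_natCast_atTop_atTop)
  simpa using hl.const_sub (avTail s₁ s₃ n X)

lemma avKern_zero (w : ℂ) (x : ℝ) : avKern w 0 0 x = (x : ℂ) ^ (-w) := by simp [avKern]

lemma zetaCont_eq_tsum {w : ℂ} (hw : 1 < w.re) :
    zetaCont w = ∑' n : ℕ, (((n : ℝ) + 1 : ℝ) : ℂ) ^ (-w) := by
  have hs : 1 < w.re + (0 : ℂ).re := by simpa using hw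
  have hk := summable_avKern_add_nat (n := 0) le_rfl zero_le_one le_rfl hs
  have ht := hasSum_avTail_sub_avTail (n := 0) le_rfl zero_le_one le_rfl hs
  have : (fun k : ℕ => avStep w 0 0 (1 + k)) = fun k : ℕ => avKern w 0 0 (1 + k) -
    (avTail w 0 0 (1 + k) - avTail w 0 0 (1 + k + 1)) := rfl
  rw [zetaCont, this, hk.tsum_sub ht.summable, ht.tsum_eq, add_sub_cancel]
  simp only [avKern_zero, add_comm (1 : ℝ)]

lemma avTail_self (s₁ s₃ : ℂ) {n : ℝ} (hn : 0 < n) :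
    avTail s₁ s₃ n n = (n : ℂ) ^ (1 - s₁ - s₃) * avTail s₁ s₃ 1 1 := by
  simpa using avTail_mul (s₁ := s₁) (s₃ := s₃) (n := 1) (x := 1) zero_le_one hn zero_le_one

lemma avKern_self (s₁ s₃ : ℂ) {n : ℝ} (hn : 0 < n) :
    avKern s₁ s₃ n n = (n : ℂ) ^ (-s₁ - s₃) * 2 ^ (-s₃) := by
  have hn' : (n : ℂ) ≠ 0 := by exact_mod_cast hn.ne'
  rw [avKern, ← two_mul, Complex.ofReal_mul, Complex.mul_cpow_ofReal_nonneg zero_le_two hn.le,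
    sub_eq_add_neg, Complex.cpow_add _ _ hn']
  push_cast
  ring

lemma tsum_eq_tsum_sum_antidiagonal {f : ℕ × ℕ → ℂ} (hf : Summable f) :
    ∑' p, f p = ∑' N, ∑ p ∈ Finset.HasAntidiagonal.antidiagonal N, f p := by
  have h := (Finset.HasAntidiagonal.sigmaAntidiagonalEquivProd (A := ℕ)).summable_iff.2 hf
  rw [← Finset.HasAntidiagonal.sigmaAntidiagonalEquivProd.tsum_eq f]
  refine (h.tsum_sigma' fun N => (hasSum_fintype _).summable).trans (tsum_congr fun N => ?_)
  rw [tsum_fintype]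
  exact Finset.sum_coe_sort (Finset.HasAntidiagonal.antidiagonal N) f

/-- The summand of the double series at `n = p.1 + 1`, `m = p.1 + 1 + p.2`. -/
noncomputable def avSummand (s₁ s₂ s₃ : ℂ) (p : ℕ × ℕ) : ℂ :=
  (((p.1 : ℝ) + 1 : ℝ) : ℂ) ^ (-s₂) * avKern s₁ s₃ ((p.1 : ℝ) + 1) ((p.1 : ℝ) + 1 + p.2)

lemma summable_avSummand {s₁ s₂ s₃ : ℂ} (hs : 1 < s₁.re + s₃.re)
    (hs' : 2 < s₁.re + s₂.re + s₃.re) : Summable (avSummand s₁ s₂ s₃) := by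
  have hmaj : Summable fun p : ℕ × ℕ => 2 ^ |s₃.re| * (((p.1 : ℝ) + 1) ^ (-s₂.re) *
      ((p.1 : ℝ) + 1 + p.2) ^ (-(s₁.re + s₃.re - 1) - 1)) :=
    (summable_rpow_mul_rpow (by linarith) (by linarith)).mul_left _
  refine Summable.of_norm_bounded hmaj fun p => ?_
  have hn : (0 : ℝ) < (p.1 : ℝ) + 1 := by positivity
  rw [avSummand, norm_mul, Complex.norm_cpow_eq_rpow_re_of_pos hn, Complex.neg_re]
  have := mul_le_mul_of_nonneg_left (norm_avKern_le s₁ s₃ hn.le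
    (show (p.1 : ℝ) + 1 ≤ (p.1 : ℝ) + 1 + p.2 by linarith [p.2.cast_nonneg (α := ℝ)])
    (by positivity)) (Real.rpow_nonneg hn.le (-s₂.re))
  refine this.trans_eq ?_
  rw [show -(s₁.re + s₃.re - 1) - 1 = -(s₁.re + s₃.re) by ring]
  ring

lemma one_div_eq_avKern (s₁ s₂ s₃ : ℂ) (n m : ℕ) :
    1 / ((m : ℂ) ^ s₁ * (n : ℂ) ^ s₂ * ((m + n : ℕ) : ℂ) ^ s₃) =
      ((n : ℝ) : ℂ) ^ (-s₂) * avKern s₁ s₃ n m := by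
  rw [avKern, Complex.cpow_neg, Complex.cpow_neg, Complex.cpow_neg]
  push_cast
  simp only [one_div, mul_inv]
  ring

/-- The antidiagonal p.1 + p.2 = N collects the terms with m = N + 2, and m = 0, 1 have empty inner
sums. The shift of the second coordinate drops the diagonal m = n. -/
lemma avSeries_eq_tsum {s₁ s₂ s₃ : ℂ} (hsum : Summable (avSummand s₁ s₂ s₃)) :
    avSeries s₁ s₂ s₃ = ∑' p : ℕ × ℕ, avSummand s₁ s₂ s₃ (p.1, p.2 + 1) := by
  have hB : Summable fun p : ℕ × ℕ => avSummand s₁ s₂ s₃ (p.1, p.2 + 1) :=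
    hsum.comp_injective (i := fun p : ℕ × ℕ => (p.1, p.2 + 1)) fun p q h => by
      simp only [Prod.mk.injEq, add_left_inj] at h
      exact Prod.ext h.1 h.2
  have hN : ∀ N : ℕ, ∑ p ∈ Finset.HasAntidiagonal.antidiagonal N,
      avSummand s₁ s₂ s₃ (p.1, p.2 + 1) =
      avInner s₁ s₂ s₃ (N + 2) := by
    intro N
    rw [avInner, Finset.sum_Ico_eq_sum_range, Finset.Nat.sum_antidiagonal_eq_sum_range_succ
      (fun i j => avSummand s₁ s₂ s₃ (i, j + 1))]
    refine Finset.sum_congr rfl fun i hi => ?_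
    have hi' : i ≤ N := Nat.lt_succ_iff.1 (Finset.mem_range.1 hi)
    rw [one_div_eq_avKern, avSummand]
    push_cast [Nat.cast_sub hi']
    ring_nf
  have hs : Summable fun N : ℕ => avInner s₁ s₂ s₃ (N + 2) := by
    have h := ((Finset.HasAntidiagonal.sigmaAntidiagonalEquivProd (A := ℕ)).summable_iff.2 hB).sigma'
      (fun N => (hasSum_fintype _).summable)
    refine h.congr fun N => ?_
    rw [tsum_fintype, ← hN]
    exact Finset.sum_coe_sort (Finset.HasAntidiagonal.antidiagonal N)
      (fun p => avSummand s₁ s₂ s₃ (p.1, p.2 + 1))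
  rw [tsum_eq_tsum_sum_antidiagonal hB, avSeries,
    ← ((summable_nat_add_iff 2).1 hs).sum_add_tsum_nat_add 2]
  simp [Finset.sum_range_succ, hN, avInner]

lemma avCont_eq_avSeries {s₁ s₂ s₃ : ℂ} (h₁ : 1 < s₁.re) (h₂ : 1 < s₂.re) (h₃ : 1 < s₃.re) :
    avCont s₁ s₂ s₃ = avSeries s₁ s₂ s₃ := by
  have hs : 1 < s₁.re + s₃.re := by linarith
  have hne : s₁ + s₃ ≠ 1 := fun h => by
    have := congrArg Complex.re h
    simp at this
    linarith
  have hA := summable_avSummand (s₂ := s₂) hs (by linarith)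
  have hE := summable_avTerm (s₂ := s₂) (s₃ := s₃) (s₁ := s₁) (by linarith) (by linarith) hne
  have hn : ∀ n : ℕ, (0 : ℝ) < (n : ℝ) + 1 := fun n => by positivity
  have hn1 : ∀ n : ℕ, (1 : ℝ) ≤ (n : ℝ) + 1 := fun n => by linarith [n.cast_nonneg (α := ℝ)]
  have hn' : ∀ n : ℕ, (((n : ℝ) + 1 : ℝ) : ℂ) ≠ 0 := fun n => by exact_mod_cast (hn n).ne'
  -- Summand minus difference is an integral over a unit interval, so the sum over `k` telescopes to
  -- the tail starting at X = n.
  have hD : ∑' p, (avSummand s₁ s₂ s₃ p - avTerm s₁ s₂ s₃ p) =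
      avTail s₁ s₃ 1 1 * zetaCont (s₁ + s₂ + s₃ - 1) := by
    rw [(hA.sub hE).tsum_prod, zetaCont_eq_tsum (by simp; linarith), ← tsum_mul_left]
    refine tsum_congr fun n => ?_
    have ht := hasSum_avTail_sub_avTail (X := (n : ℝ) + 1) (hn n).le le_rfl (hn1 n) hs
    have e : ∀ k : ℕ, avSummand s₁ s₂ s₃ (n, k) - avTerm s₁ s₂ s₃ (n, k) =
        (((n : ℝ) + 1 : ℝ) : ℂ) ^ (-s₂) * (avTail s₁ s₃ ((n : ℝ) + 1) ((n : ℝ) + 1 + k) -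
          avTail s₁ s₃ ((n : ℝ) + 1) ((n : ℝ) + 1 + k + 1)) := fun k => by
      simp only [avSummand, avTerm, avStep]
      ring
    simp only [e]
    rw [tsum_mul_left, ht.tsum_eq, avTail_self _ _ (hn n), ← mul_assoc,
      ← Complex.cpow_add _ _ (hn' n), mul_comm]
    ring_nf
  have hdiag : ∑' n : ℕ, avSummand s₁ s₂ s₃ (n, 0) =
      2 ^ (-s₃) * riemannZeta (s₁ + s₂ + s₃) := by
    rw [zeta_eq_tsum_one_div_nat_add_one_cpow (by simp; linarith), ← tsum_mul_left]
    refine tsum_congr fun n => ?_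
    rw [avSummand, Nat.cast_zero, add_zero, avKern_self _ _ (hn n), ← mul_assoc,
      ← Complex.cpow_add _ _ (hn' n), one_div, ← Complex.cpow_neg, mul_comm]
    push_cast
    ring_nf
  have hsplit : ∑' p, avSummand s₁ s₂ s₃ p = ∑' n : ℕ, avSummand s₁ s₂ s₃ (n, 0) +
      ∑' p : ℕ × ℕ, avSummand s₁ s₂ s₃ (p.1, p.2 + 1) := by
    have hB : Summable fun p : ℕ × ℕ => avSummand s₁ s₂ s₃ (p.1, p.2 + 1) :=
      hA.comp_injective (i := fun p : ℕ × ℕ => (p.1, p.2 + 1)) fun p q h => by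
        simp only [Prod.mk.injEq, add_left_inj] at h
        exact Prod.ext h.1 h.2
    have h0 : Summable fun n : ℕ => avSummand s₁ s₂ s₃ (n, 0) :=
      hA.comp_injective (i := fun n : ℕ => (n, 0)) fun p q h => by simpa using h
    rw [hA.tsum_prod, hB.tsum_prod, ← h0.tsum_add hB.prod]
    exact tsum_congr fun n => (hA.prod_factor n).tsum_eq_zero_add
  rw [hA.tsum_sub hE] at hD
  rw [avCont, ← hD, avSeries_eq_tsum hA, ← hdiag, hsplit]
  ring

lemma isAVContinuation_avCont : IsAVContinuation avCont :=
  ⟨differentiableOn_avCont, fun _ _ _ => avCont_eq_avSeries⟩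

lemma isAVContinuation_zetaAV : IsAVContinuation zetaAV := by
  have h : ∃ Z, IsAVContinuation Z := ⟨_, isAVContinuation_avCont⟩
  have e : zetaAV = h.choose := by
    funext s₁ s₂ s₃
    rw [zetaAV, dif_pos h]
  rw [e]
  exact h.choose_spec

/-! ### Uniqueness of the continuation -/

lemma exists_ne_zero_mul_nonneg (y : ℝ) : ∃ α : ℝ, α ≠ 0 ∧ 0 ≤ α * y := by
  rcases le_total 0 y with h | h
  · exact ⟨1, one_ne_zero, by linarith⟩
  · exact ⟨-1, by norm_num, by linarith⟩

/-- When Im q does not lie on the opposite side of Im p ≠ 0, the imaginary part along the segment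
can vanish only at the endpoint q, so a real c ≠ q is never met. -/
lemma add_mul_sub_ne_of_mul_im_nonneg {p q c : ℂ} {x : ℝ} (hp : p.im ≠ 0)
    (hpq : 0 ≤ p.im * q.im) (hc : c.im = 0) (hq : q ≠ c) (hx : x ∈ Icc (0 : ℝ) 1) :
    p + x * (q - p) ≠ c := by
  intro h
  rcases hx.2.lt_or_eq with h1 | rfl
  · have him := congrArg Complex.im h
    simp only [Complex.add_im, Complex.mul_im, Complex.ofReal_re, Complex.ofReal_im,
      Complex.sub_im, Complex.sub_re, zero_mul, add_zero, hc] at him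
    have hp2 : 0 < p.im * p.im := mul_self_pos.2 hp
    have hmul : p.im * (p.im + x * (q.im - p.im)) = 0 := by rw [him, mul_zero]
    linarith [mul_pos (sub_pos.2 h1) hp2, mul_nonneg hx.1 hpq]
  · exact hq (by simpa using h)

/-- Uniqueness of the continuation: every point of the domain is joined to the region of
convergence by a segment inside the domain. -/
lemma IsAVContinuation.eq {Z W : ℂ → ℂ → ℂ → ℂ} (hZ : IsAVContinuation Z)
    (hW : IsAVContinuation W) {q : ℂ × ℂ × ℂ} (hq : q ∈ avDomain) :
    Z q.1 q.2.1 q.2.2 = W q.1 q.2.1 q.2.2 := by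
  obtain ⟨h1, h2, h3, h4⟩ := hq
  obtain ⟨α, hα, hαq⟩ := exists_ne_zero_mul_nonneg (q.1 + q.2.2).im
  obtain ⟨β, hβ, hβq⟩ := exists_ne_zero_mul_nonneg (q.1 + q.2.1 + q.2.2).im
  -- All real parts are 2, inside the region of convergence. The sums s₁ + s₃ and s₁ + s₂ + s₃ get
  -- imaginary parts α and β, on the side of those of `q`, so the segment avoids both hyperplanes.
  set p : ℂ × ℂ × ℂ := (⟨2, α⟩, ⟨2, β - α⟩, 2) with hp
  let ℓ : ℂ → ℂ × ℂ × ℂ := fun z => p + z • (q - p)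
  have hℓ : Continuous ℓ := by fun_prop
  have hseg : ∀ x ∈ Icc (0 : ℝ) 1, ℓ x ∈ avDomain := by
    intro x hx
    refine ⟨?_, ?_, ?_, ?_⟩
    · simp only [ℓ, hp, Prod.fst_add, Prod.snd_add, Prod.smul_fst, Prod.smul_snd, Prod.fst_sub,
        Prod.snd_sub, smul_eq_mul, Complex.add_re, Complex.mul_re, Complex.ofReal_re,
        Complex.ofReal_im, zero_mul, sub_zero, Complex.sub_re, Complex.re_ofNat]
      nlinarith [mul_nonneg hx.1 h1.le, hx.1, hx.2]
    · simp only [ℓ, hp, Prod.fst_add, Prod.snd_add, Prod.smul_fst, Prod.smul_snd, Prod.fst_sub,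
        Prod.snd_sub, smul_eq_mul, Complex.add_re, Complex.mul_re, Complex.ofReal_re,
        Complex.ofReal_im, zero_mul, sub_zero, Complex.sub_re, Complex.re_ofNat]
      nlinarith [mul_nonneg hx.1 (sub_pos.2 h2).le, hx.1, hx.2]
    · have := add_mul_sub_ne_of_mul_im_nonneg (p := p.1 + p.2.2) (q := q.1 + q.2.2) (c := 1)
        (x := x) (by simpa [hp] using hα) (by simpa [hp] using hαq) (by simp) h3 hx
      intro h
      refine this (Eq.trans ?_ h)
      simp only [ℓ, Prod.fst_add, Prod.snd_add, Prod.smul_fst, Prod.smul_snd, Prod.fst_sub,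
        Prod.snd_sub, smul_eq_mul]
      ring
    · have := add_mul_sub_ne_of_mul_im_nonneg (p := p.1 + p.2.1 + p.2.2)
        (q := q.1 + q.2.1 + q.2.2) (c := 2)
        (x := x) (by simpa [hp] using hβ) (by simpa [hp] using hβq) (by simp) h4 hx
      intro h
      refine this (Eq.trans ?_ h)
      simp only [ℓ, Prod.fst_add, Prod.snd_add, Prod.smul_fst, Prod.smul_snd, Prod.fst_sub,
        Prod.snd_sub, smul_eq_mul]
      ring
  have hopen : IsOpen (ℓ ⁻¹' avDomain) := isOpen_avDomain.preimage hℓ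
  -- On the complex line through `p` and `q` the identity theorem in one variable suffices.
  have hana : ∀ {Y : ℂ → ℂ → ℂ → ℂ}, IsAVContinuation Y →
      AnalyticOnNhd ℂ (fun z => Y (ℓ z).1 (ℓ z).2.1 (ℓ z).2.2)
        ((fun x : ℝ => (x : ℂ)) '' Icc 0 1) := by
    rintro Y hY _ ⟨x, hx, rfl⟩
    have hd : DifferentiableOn ℂ (fun z => Y (ℓ z).1 (ℓ z).2.1 (ℓ z).2.2) (ℓ ⁻¹' avDomain) :=
      hY.holomorphic.comp (f := ℓ) (by fun_prop) (mapsTo_preimage _ _)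
    exact hd.analyticAt (hopen.mem_nhds (hseg x hx))
  have hnear : (fun z => Z (ℓ z).1 (ℓ z).2.1 (ℓ z).2.2) =ᶠ[𝓝 0]
      fun z => W (ℓ z).1 (ℓ z).2.1 (ℓ z).2.2 := by
    have c1 : Continuous fun z => (ℓ z).1.re := by fun_prop
    have c2 : Continuous fun z => (ℓ z).2.1.re := by fun_prop
    have c3 : Continuous fun z => (ℓ z).2.2.re := by fun_prop
    filter_upwards [c1.continuousAt.eventually (lt_mem_nhds (show 1 < (ℓ 0).1.re by
        simp [ℓ, hp])), c2.continuousAt.eventually (lt_mem_nhds (show 1 < (ℓ 0).2.1.re by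
        simp [ℓ, hp])), c3.continuousAt.eventually (lt_mem_nhds (show 1 < (ℓ 0).2.2.re by
        simp [ℓ, hp]))] with z k1 k2 k3
    rw [hZ.eq_series _ _ _ k1 k2 k3, hW.eq_series _ _ _ k1 k2 k3]
  have hpre : IsPreconnected ((fun x : ℝ => (x : ℂ)) '' Icc (0 : ℝ) 1) :=
    isPreconnected_Icc.image _ Complex.continuous_ofReal.continuousOn
  have := (hana hZ).eqOn_of_preconnected_of_eventuallyEq (hana hW) hpre
    ⟨0, by simp, by simp⟩ hnear ⟨1, by simp, rfl⟩
  simpa [ℓ] using this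

/-! ### The phase of the kernel over a unit step -/

/-- The derivative of exp(-z) has norm at most 1 on the right half-plane, which is convex.
Nonnegative σ₁ and σ₃ place the phase there. -/
lemma norm_exp_neg_sub_exp_neg_le {a b : ℂ} (ha : 0 ≤ a.re) (hb : 0 ≤ b.re) :
    ‖Complex.exp (-a) - Complex.exp (-b)‖ ≤ ‖a - b‖ := by
  have hconv : Convex ℝ {z : ℂ | 0 ≤ z.re} := convex_halfSpace_re_ge 0
  have := hconv.norm_image_sub_le_of_norm_hasDerivWithin_le (f := fun z => Complex.exp (-z))
    (C := 1) (f' := fun z => Complex.exp (-z) * -1) (x := b) (y := a)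
    (fun z _ => ((hasDerivAt_neg z).cexp).hasDerivWithinAt)
    (fun z hz => by
      rw [norm_mul, Complex.norm_exp, norm_neg, norm_one, mul_one, Complex.neg_re]
      exact Real.exp_le_one_iff.2 (neg_nonpos.2 hz)) hb ha
  simpa using this

lemma log_one_add_div_nonneg {u x : ℝ} (hu : 0 ≤ u) (hx : 0 < x) : 0 ≤ Real.log (1 + u / x) :=
  Real.log_nonneg (by linarith [div_nonneg hu hx.le])

lemma log_one_add_div_le {u x : ℝ} (hu : 0 ≤ u) (hu1 : u ≤ 1) (hx : 0 < x) :
    Real.log (1 + u / x) ≤ 1 / x := by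
  have h := Real.log_le_sub_one_of_pos (show 0 < 1 + u / x by positivity)
  have : u / x ≤ 1 / x := by gcongr
  linarith

lemma abs_log_one_add_div_sub_le {u x : ℝ} (hu : 0 ≤ u) (hu1 : u ≤ 1) (hx : 0 < x) :
    |Real.log (1 + u / x) - Real.log (1 + u / (x + 1))| ≤ 1 / x ^ 2 := by
  have hx1 : 0 < x + 1 := by linarith
  have hle : u / (x + 1) ≤ u / x := by gcongr; linarith
  have hp : 0 < 1 + u / (x + 1) := by positivity
  have hp' : 0 < 1 + u / x := by positivity
  rw [abs_of_nonneg (sub_nonneg.2 (Real.log_le_log hp (by linarith))),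
    ← Real.log_div hp'.ne' hp.ne']
  refine (Real.log_le_sub_one_of_pos (by positivity)).trans ?_
  have e : (1 + u / x) / (1 + u / (x + 1)) - 1 = u / (x * (x + 1 + u)) := by
    have : x + 1 + u ≠ 0 := by positivity
    field_simp
    ring
  rw [e]
  have : x ^ 2 ≤ x * (x + 1 + u) := by nlinarith
  gcongr

/-- The logarithm of the quotient of the kernel at `x` by the kernel at `x + u`. -/
noncomputable def avPhase (s₁ s₃ : ℂ) (n x u : ℝ) : ℂ :=
  s₁ * Real.log (1 + u / x) + s₃ * Real.log (1 + u / (x + n))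

lemma avKern_add_eq {s₁ s₃ : ℂ} {n x u : ℝ} (hn : 0 ≤ n) (hx : 0 < x) (hu : 0 ≤ u) :
    avKern s₁ s₃ n (x + u) = Complex.exp (-avPhase s₁ s₃ n x u) * avKern s₁ s₃ n x := by
  have key : ∀ (s : ℂ) {y : ℝ}, 0 < y → ((y + u : ℝ) : ℂ) ^ (-s) =
      Complex.exp (-(s * Real.log (1 + u / y))) * (y : ℂ) ^ (-s) := by
    intro s y hy
    have h1 : y + u = (1 + u / y) * y := by field_simp
    have h2 : 0 < 1 + u / y := by positivity
    rw [h1, Complex.ofReal_mul, Complex.mul_cpow_ofReal_nonneg h2.le hy.le,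
      Complex.cpow_def_of_ne_zero (by exact_mod_cast h2.ne'), ← Complex.ofReal_log h2.le]
    ring_nf
  rw [avKern, avKern, key s₁ hx, show x + u + n = x + n + u by ring,
    key s₃ (show 0 < x + n by positivity), avPhase, neg_add, Complex.exp_add]
  ring

section Phase

variable {s₁ s₃ : ℂ} {n x u : ℝ}

lemma avPhase_re_nonneg (h₁ : 0 ≤ s₁.re) (h₃ : 0 ≤ s₃.re) (hn : 0 ≤ n) (hx : 0 < x)
    (hu : 0 ≤ u) : 0 ≤ (avPhase s₁ s₃ n x u).re := by
  have := log_one_add_div_nonneg hu hx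
  have := log_one_add_div_nonneg hu (show 0 < x + n by positivity)
  simp only [avPhase, Complex.add_re, Complex.re_mul_ofReal]
  positivity

lemma norm_avPhase_le (hn : 0 ≤ n) (hx : 0 < x) (hu : 0 ≤ u) (hu1 : u ≤ 1) :
    ‖avPhase s₁ s₃ n x u‖ ≤ (‖s₁‖ + ‖s₃‖) / x := by
  have hxn : 0 < x + n := by positivity
  have h1 := log_one_add_div_le hu hu1 hx
  have h3 : Real.log (1 + u / (x + n)) ≤ 1 / x :=
    (log_one_add_div_le hu hu1 hxn).trans (by gcongr; linarith)
  refine (norm_add_le _ _).trans ?_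
  rw [norm_mul, norm_mul, Complex.norm_of_nonneg (log_one_add_div_nonneg hu hx),
    Complex.norm_of_nonneg (log_one_add_div_nonneg hu hxn)]
  calc _ ≤ ‖s₁‖ * (1 / x) + ‖s₃‖ * (1 / x) := by gcongr
    _ = _ := by ring

/-- The change from `x` to `x + 1` is one order in x smaller than the phase itself. This slow
variation is what Abel summation exploits. -/
lemma norm_avPhase_sub_le (hn : 0 ≤ n) (hx : 0 < x) (hu : 0 ≤ u) (hu1 : u ≤ 1) :
    ‖avPhase s₁ s₃ n x u - avPhase s₁ s₃ n (x + 1) u‖ ≤ (‖s₁‖ + ‖s₃‖) / x ^ 2 := by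
  have hxn : 0 < x + n := by positivity
  have h1 := abs_log_one_add_div_sub_le hu hu1 hx
  have h3 : |Real.log (1 + u / (x + n)) - Real.log (1 + u / (x + n + 1))| ≤ 1 / x ^ 2 :=
    (abs_log_one_add_div_sub_le hu hu1 hxn).trans (by gcongr; linarith)
  have e : avPhase s₁ s₃ n x u - avPhase s₁ s₃ n (x + 1) u =
      s₁ * ((Real.log (1 + u / x) - Real.log (1 + u / (x + 1)) : ℝ) : ℂ) +
      s₃ * ((Real.log (1 + u / (x + n)) - Real.log (1 + u / (x + n + 1)) : ℝ) : ℂ) := by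
    rw [avPhase, avPhase, show x + 1 + n = x + n + 1 by ring]
    push_cast
    ring
  rw [e]
  refine (norm_add_le _ _).trans ?_
  rw [norm_mul, norm_mul, Complex.norm_real, Complex.norm_real, Real.norm_eq_abs,
    Real.norm_eq_abs]
  calc _ ≤ ‖s₁‖ * (1 / x ^ 2) + ‖s₃‖ * (1 / x ^ 2) := by gcongr
    _ = _ := by ring

lemma intervalIntegrable_exp_avPhase (hn : 0 ≤ n) (hx : 0 < x) :
    IntervalIntegrable (fun u => Complex.exp (-avPhase s₁ s₃ n x u)) volume 0 1 := by
  refine ContinuousOn.intervalIntegrable fun u hu => ContinuousAt.continuousWithinAt ?_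
  rw [uIcc_of_le zero_le_one] at hu
  have hu := hu.1
  have hxn : 0 < x + n := by positivity
  have hlog : ∀ {y : ℝ}, 0 < y → ContinuousAt (fun u : ℝ => ((Real.log (1 + u / y) : ℝ) : ℂ)) u :=
    fun {y} hy => Complex.continuous_ofReal.continuousAt.comp
      (ContinuousAt.log (by fun_prop) (by positivity))
  have h1 := hlog hx
  have h3 := hlog hxn
  unfold avPhase
  fun_prop

/-- The average of `1 - avKern (x + u) / avKern x` over `0 ≤ u ≤ 1`. -/
noncomputable def avDefect (s₁ s₃ : ℂ) (n x : ℝ) : ℂ :=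
  ∫ u in (0 : ℝ)..1, (1 - Complex.exp (-avPhase s₁ s₃ n x u))

lemma avStep_eq_mul_avDefect (hn : 0 ≤ n) (hx : 0 < x) (hs : 0 < s₁.re + s₃.re)
    (hne : s₁ + s₃ ≠ 1) :
    avStep s₁ s₃ n x = avKern s₁ s₃ n x * avDefect s₁ s₃ n x := by
  rw [avStep_eq_integral hn hx hs hne, avDefect, ← intervalIntegral.integral_const_mul]
  refine intervalIntegral.integral_congr fun u hu => ?_
  rw [uIcc_of_le zero_le_one] at hu
  simp only [avKern_add_eq hn hx hu.1]
  ring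

lemma norm_one_sub_exp_avPhase_le (h₁ : 0 ≤ s₁.re) (h₃ : 0 ≤ s₃.re) (hn : 0 ≤ n) (hx : 0 < x)
    (hu : 0 ≤ u) (hu1 : u ≤ 1) :
    ‖1 - Complex.exp (-avPhase s₁ s₃ n x u)‖ ≤ (‖s₁‖ + ‖s₃‖) / x := by
  have := norm_exp_neg_sub_exp_neg_le (a := 0) le_rfl (avPhase_re_nonneg h₁ h₃ hn hx hu)
  rw [neg_zero, Complex.exp_zero, zero_sub, norm_neg] at this
  exact this.trans (norm_avPhase_le hn hx hu hu1)

lemma norm_exp_avPhase_sub_le (h₁ : 0 ≤ s₁.re) (h₃ : 0 ≤ s₃.re) (hn : 0 ≤ n) (hx : 0 < x)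
    (hu : 0 ≤ u) (hu1 : u ≤ 1) :
    ‖Complex.exp (-avPhase s₁ s₃ n x u) - Complex.exp (-avPhase s₁ s₃ n (x + 1) u)‖ ≤
      (‖s₁‖ + ‖s₃‖) / x ^ 2 :=
  (norm_exp_neg_sub_exp_neg_le (avPhase_re_nonneg h₁ h₃ hn hx hu)
    (avPhase_re_nonneg h₁ h₃ hn (by linarith) hu)).trans (norm_avPhase_sub_le hn hx hu hu1)

lemma norm_avDefect_le (h₁ : 0 ≤ s₁.re) (h₃ : 0 ≤ s₃.re) (hn : 0 ≤ n) (hx : 0 < x) :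
    ‖avDefect s₁ s₃ n x‖ ≤ (‖s₁‖ + ‖s₃‖) / x := by
  have := intervalIntegral.norm_integral_le_of_norm_le_const (a := 0) (b := 1)
    (f := fun u => 1 - Complex.exp (-avPhase s₁ s₃ n x u)) (C := (‖s₁‖ + ‖s₃‖) / x)
    fun u hu => by
      rw [uIoc_of_le zero_le_one] at hu
      exact norm_one_sub_exp_avPhase_le h₁ h₃ hn hx hu.1.le hu.2
  simpa [avDefect] using this

lemma norm_avDefect_sub_le (h₁ : 0 ≤ s₁.re) (h₃ : 0 ≤ s₃.re) (hn : 0 ≤ n) (hx : 0 < x) :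
    ‖avDefect s₁ s₃ n (x + 1) - avDefect s₁ s₃ n x‖ ≤ (‖s₁‖ + ‖s₃‖) / x ^ 2 := by
  have hi : ∀ {y : ℝ}, 0 < y →
      IntervalIntegrable (fun u => 1 - Complex.exp (-avPhase s₁ s₃ n y u)) volume 0 1 :=
    fun hy => intervalIntegrable_const.sub (intervalIntegrable_exp_avPhase hn hy)
  rw [avDefect, avDefect, ← intervalIntegral.integral_sub (hi (by linarith)) (hi hx)]
  have := intervalIntegral.norm_integral_le_of_norm_le_const (a := 0) (b := 1)
    (f := fun u => 1 - Complex.exp (-avPhase s₁ s₃ n (x + 1) u) -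
      (1 - Complex.exp (-avPhase s₁ s₃ n x u))) (C := (‖s₁‖ + ‖s₃‖) / x ^ 2)
    fun u hu => by
      rw [uIoc_of_le zero_le_one] at hu
      rw [sub_sub_sub_cancel_left]
      exact norm_exp_avPhase_sub_le h₁ h₃ hn hx hu.1.le hu.2
  simpa using this

/-- The imaginary part of the phase lies in [t₃/(3x), π/2]: t₁ ≥ 0 excludes cancellation and x ≥ a
t₃ excludes a full turn. The sine is at least 2/π ≥ 1/2 times its argument, whence 1/6, and the
damping is at least exp(-(σ₁+σ₃)). -/
lemma le_norm_exp_avPhase_sub_one (h₁ : 0 ≤ s₁.re) (h₃ : 0 ≤ s₃.re) (ht₁ : 0 ≤ s₁.im)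
    (ht₃ : 2 ≤ s₃.im) (hn : 0 ≤ n) (hnx : n ≤ x) (hx : max 1 |s₁.im| * s₃.im ≤ x) :
    Real.exp (-(s₁.re + s₃.re)) / 6 * (s₃.im / x) ≤
      ‖Complex.exp (-avPhase s₁ s₃ n x 1) - 1‖ := by
  have ha : s₃.im ≤ x := le_trans (le_mul_of_one_le_left (by linarith) (le_max_left _ _)) hx
  have hx0 : 0 < x := by linarith
  have hx1 : 1 ≤ x := by linarith
  have hxn : 0 < x + n := by positivity
  set φ := avPhase s₁ s₃ n x 1 with hφ
  have hl1 := log_one_add_div_le zero_le_one le_rfl hx0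
  have hl3 : Real.log (1 + 1 / (x + n)) ≤ 1 / x :=
    (log_one_add_div_le zero_le_one le_rfl hxn).trans (by gcongr; linarith)
  have hp1 := log_one_add_div_nonneg zero_le_one hx0
  have hp3 := log_one_add_div_nonneg zero_le_one hxn
  have hre : φ.re ≤ s₁.re + s₃.re := by
    have h1x : 1 / x ≤ 1 := by rw [div_le_one hx0]; exact hx1
    simp only [hφ, avPhase, Complex.add_re, Complex.re_mul_ofReal]
    nlinarith [mul_le_mul_of_nonneg_left (hl1.trans h1x) h₁,
      mul_le_mul_of_nonneg_left (hl3.trans h1x) h₃]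
  have him : φ.im = s₁.im * Real.log (1 + 1 / x) + s₃.im * Real.log (1 + 1 / (x + n)) := by
    simp only [hφ, avPhase, Complex.add_im, Complex.im_mul_ofReal]
  -- From x ≥ a t₃ and t₃ ≥ 2 come t₁/x ≤ 1/2 and t₃/x ≤ 1, in total 3/2 < π/2.
  have himle : φ.im ≤ Real.pi / 2 := by
    have k1 : s₁.im * (1 / x) ≤ 1 / 2 := by
      have : s₁.im * 2 ≤ x := by
        refine le_trans ?_ hx
        exact mul_le_mul ((le_abs_self _).trans (le_max_right _ _)) ht₃ (by norm_num)
          (by positivity)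
      rw [mul_one_div, div_le_iff₀ hx0]
      linarith
    have k3 : s₃.im * (1 / x) ≤ 1 := by
      rw [mul_one_div, div_le_one hx0]
      exact ha
    rw [him]
    nlinarith [mul_le_mul_of_nonneg_left hl1 ht₁,
      mul_le_mul_of_nonneg_left hl3 (show 0 ≤ s₃.im by linarith), Real.pi_gt_three]
  have himge : s₃.im / (3 * x) ≤ φ.im := by
    have k : 1 / (3 * x) ≤ Real.log (1 + 1 / (x + n)) := by
      have h := Real.one_sub_inv_le_log_of_pos (show 0 < 1 + 1 / (x + n) by positivity)
      have e : 1 - (1 + 1 / (x + n))⁻¹ = 1 / (x + n + 1) := by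
        have : x + n + 1 ≠ 0 := by positivity
        field_simp
        ring
      rw [e] at h
      refine le_trans ?_ h
      gcongr
      linarith
    rw [him]
    have := mul_le_mul_of_nonneg_left k (show 0 ≤ s₃.im by linarith)
    have := mul_nonneg ht₁ hp1
    have e : s₃.im / (3 * x) = s₃.im * (1 / (3 * x)) := by ring
    linarith
  have himp : 0 ≤ φ.im := le_trans (by positivity) himge
  have hsin := Real.mul_le_sin himp himle
  have himexp : (Complex.exp (-φ) - 1).im = -(Real.exp (-φ.re) * Real.sin φ.im) := by
    simp [Complex.exp_im]
  have hE : Real.exp (-(s₁.re + s₃.re)) ≤ Real.exp (-φ.re) := Real.exp_le_exp.2 (by linarith)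
  have hπ : (1 : ℝ) / 2 ≤ 2 / Real.pi := by
    rw [div_le_div_iff₀ two_pos Real.pi_pos]
    linarith [Real.pi_le_four]
  calc Real.exp (-(s₁.re + s₃.re)) / 6 * (s₃.im / x)
      = Real.exp (-(s₁.re + s₃.re)) * (1 / 2 * (s₃.im / (3 * x))) := by
        field_simp
        ring
    _ ≤ Real.exp (-φ.re) * (2 / Real.pi * φ.im) := by gcongr
    _ ≤ Real.exp (-φ.re) * Real.sin φ.im := by gcongr
    _ ≤ |(Complex.exp (-φ) - 1).im| := by
        rw [himexp, abs_neg]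
        exact le_abs_self _
    _ ≤ _ := Complex.abs_im_le_norm _

end Phase

/-! ### Abel summation and the tail sums of differences -/

lemma sum_range_sub_mul (f p : ℕ → ℂ) (K : ℕ) :
    ∑ k ∈ Finset.range K, (f (k + 1) - f k) * p k =
      f K * p K - f 0 * p 0 - ∑ k ∈ Finset.range K, f (k + 1) * (p (k + 1) - p k) := by
  induction K with
  | zero => simp
  | succ K ih =>
    rw [Finset.sum_range_succ, ih, Finset.sum_range_succ]
    ring

/-- Abel summation moves the difference onto `p`. The two boundary terms give 2A; the rest is a sum
of (X+k+1)^{-τ-1}, with 2B absorbing the passage from X + k to X + k + 1. -/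
lemma norm_sum_sub_mul_le {f p : ℕ → ℂ} {M A B τ X : ℝ} (hτ : 0 < τ) (hX : 1 ≤ X) (hM : 0 ≤ M)
    (hA : 0 ≤ A) (hB : 0 ≤ B) (hf : ∀ k : ℕ, ‖f k‖ ≤ M * (X + k) ^ (-τ))
    (hp : ∀ k, ‖p k‖ ≤ A) (hdp : ∀ k : ℕ, ‖p (k + 1) - p k‖ ≤ B / (X + k)) (K : ℕ) :
    ‖∑ k ∈ Finset.range K, (f (k + 1) - f k) * p k‖ ≤ M * (2 * A + 2 * B / τ) * X ^ (-τ) := by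
  have hX0 : 0 < X := by linarith
  have hb : ∀ k : ℕ, ‖f k * p k‖ ≤ M * A * X ^ (-τ) := by
    intro k
    rw [norm_mul]
    calc _ ≤ M * (X + k) ^ (-τ) * A := mul_le_mul (hf k) (hp k) (norm_nonneg _) (by positivity)
      _ ≤ M * X ^ (-τ) * A := by
        have : (X + k) ^ (-τ) ≤ X ^ (-τ) :=
          Real.rpow_le_rpow_of_nonpos hX0 (by linarith [k.cast_nonneg (α := ℝ)]) (by linarith)
        gcongr
      _ = _ := by ring
  have hs : ‖∑ k ∈ Finset.range K, f (k + 1) * (p (k + 1) - p k)‖ ≤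
      M * (2 * B) * (X ^ (-τ) / τ) := by
    refine (norm_sum_le _ _).trans ?_
    refine le_trans (Finset.sum_le_sum fun k _ => ?_)
      (le_trans (Finset.mul_sum _ _ _).ge (mul_le_mul_of_nonneg_left
        (sum_range_rpow_succ_le hτ hX0 K) (by positivity)))
    have hXk : 0 < X + k := by positivity
    have h1 := hf (k + 1)
    push_cast at h1
    rw [← add_assoc] at h1
    have h2 : B / (X + k) ≤ 2 * B / (X + k + 1) := by
      rw [div_le_div_iff₀ hXk (by positivity)]
      nlinarith [k.cast_nonneg (α := ℝ), mul_nonneg hB (show 0 ≤ X + k - 1 by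
        linarith [k.cast_nonneg (α := ℝ)])]
    rw [norm_mul]
    calc _ ≤ M * (X + k + 1) ^ (-τ) * (2 * B / (X + k + 1)) :=
          mul_le_mul h1 ((hdp k).trans h2) (norm_nonneg _) (by positivity)
      _ = _ := by
        rw [Real.rpow_sub_one (by positivity)]
        ring
  rw [sum_range_sub_mul]
  have h1 := norm_sub_le (f K * p K - f 0 * p 0)
    (∑ k ∈ Finset.range K, f (k + 1) * (p (k + 1) - p k))
  have h2 := norm_sub_le (f K * p K) (f 0 * p 0)
  calc _ ≤ M * A * X ^ (-τ) + M * A * X ^ (-τ) + M * (2 * B) * (X ^ (-τ) / τ) := by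
        linarith [hb K, hb 0]
    _ = _ := by ring

lemma norm_le_mul_im {s₃ : ℂ} (h₃ : 0 ≤ s₃.re) (ht₃ : 1 ≤ s₃.im) :
    ‖s₃‖ ≤ (s₃.re + 1) * s₃.im := by
  have := Complex.norm_le_abs_re_add_abs_im s₃
  rw [abs_of_nonneg h₃, abs_of_nonneg (by linarith : 0 ≤ s₃.im)] at this
  nlinarith

/-- The tail sums of the differences between summand and integral, in the range where the phase
of the summand varies slowly. -/
lemma exists_norm_tsum_avStep_le (s₁ : ℂ) (σ₃ : ℝ) (h₁ : 0 ≤ s₁.re) (ht₁ : 0 ≤ s₁.im)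
    (h₃ : 0 ≤ σ₃) (hσ : 0 < s₁.re + σ₃) :
    ∃ C : ℝ, 0 ≤ C ∧ ∀ s₃ : ℂ, s₃.re = σ₃ → 2 ≤ s₃.im → ∀ n X : ℝ, 0 ≤ n → n ≤ X →
      max 1 |s₁.im| * s₃.im ≤ X →
      ‖∑' k : ℕ, avStep s₁ s₃ n (X + k)‖ ≤ C * X ^ (-(s₁.re + σ₃)) := by
  set c := Real.exp (-(s₁.re + σ₃)) / 6 with hc
  have hc0 : 0 < c := by positivity
  -- `A` will bound η/r: η is at most (‖s₁‖ + σ₃ + 1) t₃/x and r at least c t₃/x, so t₃ cancels.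
  set A := (‖s₁‖ + (σ₃ + 1)) / c with hA
  have hA0 : 0 ≤ A := by positivity
  refine ⟨2 ^ |σ₃| * (2 * A + 2 * (2 * A + 2 * A ^ 2) / (s₁.re + σ₃)), by positivity, ?_⟩
  rintro s₃ rfl ht₃ n X hn hnX hX
  have ht0 : 0 < s₃.im := by linarith
  have hX2 : s₃.im ≤ X := le_trans (le_mul_of_one_le_left ht0.le (le_max_left _ _)) hX
  have hX1 : 1 ≤ X := by linarith
  have hXk : ∀ k : ℕ, X ≤ X + k := fun k => by linarith [k.cast_nonneg (α := ℝ)]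
  have hXk0 : ∀ k : ℕ, 0 < X + k := fun k => by linarith [hXk k]
  have hne : s₁ + s₃ ≠ 1 := fun h => by
    have := congrArg Complex.im h
    simp at this
    linarith
  set K := ‖s₁‖ + ‖s₃‖ with hK
  have hKA : K ≤ A * (c * s₃.im) := by
    have h1 : A * (c * s₃.im) = (‖s₁‖ + (s₃.re + 1)) * s₃.im := by
      rw [hA]
      field_simp
    rw [h1]
    nlinarith [norm_le_mul_im h₃ (by linarith : 1 ≤ s₃.im), norm_nonneg s₁]
  -- With f(k) the kernel at X + k, f(k+1) - f(k) = f(k) r(k) and the k-th difference is f(k) η(k).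
  -- Each term is thus (f(k+1) - f(k)) times the slowly varying quotient η(k)/r(k).
  set r : ℕ → ℂ := fun k => Complex.exp (-avPhase s₁ s₃ n (X + k) 1) - 1 with hr
  set η : ℕ → ℂ := fun k => avDefect s₁ s₃ n (X + k) with hη
  have hr_ge : ∀ k, c * (s₃.im / (X + k)) ≤ ‖r k‖ := fun k =>
    le_norm_exp_avPhase_sub_one h₁ h₃ ht₁ ht₃ hn (hnX.trans (hXk k)) (hX.trans (hXk k))
  have hr_pos : ∀ k, 0 < ‖r k‖ := fun k =>
    lt_of_lt_of_le (mul_pos hc0 (div_pos ht0 (hXk0 k))) (hr_ge k)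
  have hr_ne : ∀ k, r k ≠ 0 := fun k => norm_pos_iff.1 (hr_pos k)
  have hsucc : ∀ k : ℕ, X + ((k + 1 : ℕ) : ℝ) = X + k + 1 := fun k => by push_cast; ring
  have hη_le : ∀ k, ‖η k‖ ≤ K / (X + k) := fun k => norm_avDefect_le h₁ h₃ hn (hXk0 k)
  have hKr : ∀ k, K / (X + k) ≤ A * ‖r k‖ := fun k => by
    calc K / (X + k) ≤ A * (c * s₃.im) / (X + k) := by
          have := hXk0 k
          gcongr
      _ = A * (c * (s₃.im / (X + k))) := by ring
      _ ≤ _ := mul_le_mul_of_nonneg_left (hr_ge k) hA0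
  have hp : ∀ k, ‖η k / r k‖ ≤ A := fun k => by
    rw [norm_div, div_le_iff₀ (hr_pos k)]
    exact (hη_le k).trans (hKr k)
  have hdη : ∀ k, ‖η (k + 1) - η k‖ ≤ K / (X + k) ^ 2 := fun k => by
    simp only [hη, hsucc]
    exact norm_avDefect_sub_le h₁ h₃ hn (hXk0 k)
  have hdr : ∀ k, ‖r k - r (k + 1)‖ ≤ K / (X + k) ^ 2 := fun k => by
    simp only [hr, hsucc, sub_sub_sub_cancel_right]
    exact norm_exp_avPhase_sub_le h₁ h₃ hn (hXk0 k) zero_le_one le_rfl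
  have hKr2 : ∀ k, K / (X + k) ^ 2 ≤ 2 * A / (X + k) * ‖r (k + 1)‖ := fun k => by
    have h0 := hXk0 k
    have hk1 := hKr (k + 1)
    rw [hsucc] at hk1
    have hK0 : 0 ≤ K := by positivity
    have h2 : K / (X + k) ≤ 2 * (K / (X + k + 1)) := by
      rw [← mul_div_assoc, div_le_div_iff₀ h0 (by linarith)]
      nlinarith [mul_nonneg hK0 (show 0 ≤ X + k - 1 by linarith [hXk k])]
    calc K / (X + k) ^ 2 = K / (X + k) / (X + k) := by rw [sq, div_div]
      _ ≤ 2 * (A * ‖r (k + 1)‖) / (X + k) := by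
        gcongr
        linarith
      _ = _ := by ring
  have hdp : ∀ k : ℕ, ‖η (k + 1) / r (k + 1) - η k / r k‖ ≤ (2 * A + 2 * A ^ 2) / (X + k) := by
    intro k
    have h0 := hXk0 k
    have e : η (k + 1) / r (k + 1) - η k / r k =
        (η (k + 1) - η k) / r (k + 1) + η k / r k * ((r k - r (k + 1)) / r (k + 1)) := by
      have h1 := hr_ne k
      have h2 := hr_ne (k + 1)
      field_simp
      ring
    have b1 : ‖(η (k + 1) - η k) / r (k + 1)‖ ≤ 2 * A / (X + k) := by
      rw [norm_div, div_le_iff₀ (hr_pos _)]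
      exact (hdη k).trans (hKr2 k)
    have b2 : ‖(r k - r (k + 1)) / r (k + 1)‖ ≤ 2 * A / (X + k) := by
      rw [norm_div, div_le_iff₀ (hr_pos _)]
      exact (hdr k).trans (hKr2 k)
    rw [e]
    refine (norm_add_le _ _).trans ?_
    rw [norm_mul]
    have := mul_le_mul (hp k) b2 (norm_nonneg _) hA0
    calc _ ≤ 2 * A / (X + k) + A * (2 * A / (X + k)) := add_le_add b1 this
      _ = _ := by ring
  have hf : ∀ k : ℕ, ‖avKern s₁ s₃ n (X + k)‖ ≤ 2 ^ |s₃.re| * (X + k) ^ (-(s₁.re + s₃.re)) :=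
    fun k => norm_avKern_le _ _ hn (hnX.trans (hXk k)) (hXk0 k)
  have hbound := fun N : ℕ => norm_sum_sub_mul_le (f := fun k : ℕ => avKern s₁ s₃ n (X + k))
    (p := fun k => η k / r k) hσ hX1 (by positivity) hA0
    (show 0 ≤ 2 * A + 2 * A ^ 2 by positivity) hf hp hdp N
  have hterm : ∀ k : ℕ, (avKern s₁ s₃ n (X + (k + 1 : ℕ)) - avKern s₁ s₃ n (X + k)) *
      (η k / r k) = avStep s₁ s₃ n (X + k) := by
    intro k
    rw [hsucc, avKern_add_eq hn (hXk0 k) zero_le_one,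
      avStep_eq_mul_avDefect hn (hXk0 k) hσ hne]
    have h1 := hr_ne k
    calc _ = avKern s₁ s₃ n (X + k) * (r k * (η k / r k)) := by simp only [hr]; ring
      _ = _ := by rw [mul_div_cancel₀ _ h1]
  simp only [hterm] at hbound
  exact le_of_tendsto (summable_avStep_add_nat hn hnX hX1 hσ hne).hasSum.tendsto_sum_nat.norm
    (Eventually.of_forall hbound)

/-! ### The first derivative test for the tail integral -/

/-- The oscillatory integral of the kernel gains a factor `1 / t₃` over the trivial bound. -/
lemma norm_integral_avKern_add_one_le {s₁ s₃ : ℂ} {n X : ℝ} (ht₁ : 0 ≤ s₁.im)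
    (ht₃ : 1 ≤ s₃.im) (h₃ : 0 ≤ s₃.re) (hσ : 0 < s₁.re + s₃.re) (hn : 0 ≤ n) (hX : 0 < X)
    (hnX : n ≤ X) :
    ‖∫ u in Ioi X, avKern s₁ (s₃ + 1) n u‖ ≤
      2 ^ (s₃.re + 1) * (1 + (3 + 2 * (‖s₁‖ + s₃.re + 2)) / (s₁.re + s₃.re)) *
        (X ^ (-(s₁.re + s₃.re)) / s₃.im) := by
  set σ := s₁.re + s₃.re with hσd
  set t := s₃.im with ht
  set κ := 3 + 2 * (‖s₁‖ + s₃.re + 2) with hκ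
  have ht0 : 0 < t := by linarith
  -- For the integrand F one has L(u) = -u(u+n) F'(u)/F(u). Hence u(u+n)F/L, which is the kernel
  -- with s₁ - 1 and s₃ divided by L, has derivative -F up to the error F·Er, with Er = O(1/t₃).
  let L : ℝ → ℂ := fun u => (s₁ + s₃ + 1) * u + s₁ * n
  have hLim : ∀ u : ℝ, 0 ≤ u → t * u ≤ ‖L u‖ := by
    intro u hu
    refine le_trans ?_ ((le_abs_self _).trans (Complex.abs_im_le_norm _))
    simp only [L, Complex.add_im, Complex.im_mul_ofReal, Complex.one_im, add_zero]
    nlinarith [mul_nonneg ht₁ hu, mul_nonneg ht₁ hn]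
  have hLpos : ∀ u : ℝ, 0 < u → 0 < ‖L u‖ := fun u hu =>
    (mul_pos ht0 hu).trans_le (hLim u hu.le)
  have hLne : ∀ u : ℝ, 0 < u → L u ≠ 0 := fun u hu => norm_pos_iff.1 (hLpos u hu)
  let F : ℝ → ℂ := avKern s₁ (s₃ + 1) n
  let Er : ℝ → ℂ := fun u => (2 * u + n) / L u - u * (u + n) * (s₁ + s₃ + 1) / L u ^ 2
  have hF : IntegrableOn F (Ioi X) := integrableOn_avKern hn hX (by simp; linarith)
  have hFle : ∀ u, X < u → ‖F u‖ ≤ 2 ^ (s₃.re + 1) * u ^ (-σ - 1) := by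
    intro u hu
    have := norm_avKern_le s₁ (s₃ + 1) hn (hnX.trans hu.le) (hX.trans hu)
    rw [Complex.add_re, Complex.one_re, abs_of_nonneg (by linarith),
      show -(s₁.re + (s₃.re + 1)) = -σ - 1 by rw [hσd]; ring] at this
    exact this
  have hs : ‖s₁ + s₃ + 1‖ ≤ (‖s₁‖ + s₃.re + 2) * t := by
    have h1 := norm_add₃_le (a := s₁) (b := s₃) (c := (1 : ℂ))
    rw [norm_one] at h1
    nlinarith [norm_le_mul_im h₃ ht₃, norm_nonneg s₁]
  have hEr : ∀ u, X < u → ‖Er u‖ ≤ κ / t := by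
    intro u hu
    have hu0 : 0 < u := hX.trans hu
    have hnu : n ≤ u := hnX.trans hu.le
    have htu := mul_pos ht0 hu0
    have e1 : ‖(2 * u + n : ℂ) / L u‖ ≤ 3 / t := by
      have : (2 * u + n : ℂ) = ((2 * u + n : ℝ) : ℂ) := by push_cast; ring
      rw [norm_div, this, Complex.norm_of_nonneg (by positivity)]
      calc _ ≤ 3 * u / (t * u) := by
            gcongr
            · linarith
            · exact hLim u hu0.le
        _ = _ := by field_simp
    have e2 : ‖(u * (u + n) * (s₁ + s₃ + 1) : ℂ) / L u ^ 2‖ ≤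
        2 * (‖s₁‖ + s₃.re + 2) / t := by
      have : (u * (u + n) : ℂ) = ((u * (u + n) : ℝ) : ℂ) := by push_cast; ring
      rw [norm_div, norm_mul, this, Complex.norm_of_nonneg (by positivity), norm_pow]
      calc _ ≤ u * (u + u) * ((‖s₁‖ + s₃.re + 2) * t) / (t * u) ^ 2 := by
            gcongr
            exact hLim u hu0.le
        _ = _ := by field_simp; ring
    calc _ ≤ 3 / t + 2 * (‖s₁‖ + s₃.re + 2) / t := (norm_sub_le _ _).trans (add_le_add e1 e2)
      _ = _ := by rw [hκ]; ring
  have hFEle : ∀ u, X < u → ‖F u * Er u‖ ≤ 2 ^ (s₃.re + 1) * (κ / t) * u ^ (-σ - 1) := by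
    intro u hu
    have hu0 : 0 < u := hX.trans hu
    rw [norm_mul]
    calc _ ≤ 2 ^ (s₃.re + 1) * u ^ (-σ - 1) * (κ / t) :=
          mul_le_mul (hFle u hu) (hEr u hu) (norm_nonneg _) (by positivity)
      _ = _ := by ring
  have hmaj : IntegrableOn (fun u : ℝ => 2 ^ (s₃.re + 1) * (κ / t) * u ^ (-σ - 1)) (Ioi X) :=
    (integrableOn_Ioi_rpow_of_lt (by linarith) hX).const_mul _
  have hae : ∀ᵐ u ∂volume.restrict (Ioi X),
      ‖F u * Er u‖ ≤ 2 ^ (s₃.re + 1) * (κ / t) * u ^ (-σ - 1) :=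
    (ae_restrict_iff' measurableSet_Ioi).2 (ae_of_all _ hFEle)
  have hFE : IntegrableOn (fun u => F u * Er u) (Ioi X) := by
    refine Integrable.mono' hmaj (Measurable.aestronglyMeasurable ?_) hae
    have hm := measurable_avKern s₁ (s₃ + 1) n
    simp only [F, Er, L]
    fun_prop
  have hder : ∀ u ∈ Ici X, HasDerivAt (fun u => avKern (s₁ - 1) s₃ n u / L u)
      (-F u + F u * Er u) u := by
    intro u hu
    have hu0 : 0 < u := hX.trans_le hu
    have hd1 := hasDerivAt_avKern (s₁ - 1) s₃ hn hu0
    have hd2 : HasDerivAt L (s₁ + s₃ + 1) u := by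
      have := (((hasDerivAt_id (u : ℂ)).const_mul (s₁ + s₃ + 1)).add_const (s₁ * n)).comp_ofReal
      simpa [L] using this
    refine (hd1.div hd2 (hLne u hu0)).congr_deriv ?_
    have hL := hLne u hu0
    rw [sub_add_cancel, avKern_sub_one_left s₁ s₃ hu0, avKern_sub_one_left s₁ (s₃ + 1) hu0,
      avKern_eq_add_mul s₁ s₃ hn hu0]
    simp only [Er, F]
    have hLdef : L u = (s₁ + s₃ + 1) * u + s₁ * n := rfl
    have hexp : (-(s₁ - 1) * ((u + n) * avKern s₁ (s₃ + 1) n u) -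
        s₃ * (u * avKern s₁ (s₃ + 1) n u)) =
        avKern s₁ (s₃ + 1) n u * (-L u + 2 * u + n) := by
      rw [hLdef]
      ring
    rw [hexp]
    field_simp
    ring
  have hG : ∀ u, X ≤ u → ‖avKern (s₁ - 1) s₃ n u / L u‖ ≤ 2 ^ (s₃.re + 1) / t * u ^ (-σ) := by
    intro u hu
    have hu0 : 0 < u := hX.trans_le hu
    have h1 := norm_avKern_le s₁ s₃ hn (hnX.trans hu) hu0
    rw [abs_of_nonneg h₃] at h1
    have h2 : (2 : ℝ) ^ s₃.re ≤ 2 ^ (s₃.re + 1) :=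
      Real.rpow_le_rpow_of_exponent_le (by norm_num) (by linarith)
    rw [avKern_sub_one_left _ _ hu0, norm_div, norm_mul, Complex.norm_of_nonneg hu0.le]
    calc _ ≤ u * (2 ^ (s₃.re + 1) * u ^ (-σ)) / (t * u) := by
          have := mul_pos ht0 hu0
          gcongr
          · exact h1.trans (by gcongr)
          · exact hLim u hu0.le
      _ = _ := by field_simp
  have hlim : Tendsto (fun u => avKern (s₁ - 1) s₃ n u / L u) atTop (𝓝 0) := by
    have hl := (tendsto_rpow_neg_atTop hσ).const_mul (2 ^ (s₃.re + 1) / t)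
    rw [mul_zero] at hl
    refine squeeze_zero_norm' ?_ hl
    filter_upwards [eventually_ge_atTop X] with u hu using hG u hu
  have hint := integral_Ioi_of_hasDerivAt_of_tendsto' hder (hF.neg.add hFE) hlim
  have hint2 : ∫ u in Ioi X, F u = avKern (s₁ - 1) s₃ n X / L X + ∫ u in Ioi X, F u * Er u := by
    have h1 : ∫ u in Ioi X, (-F u + F u * Er u) =
        -(∫ u in Ioi X, F u) + ∫ u in Ioi X, F u * Er u := by
      rw [← integral_neg]
      exact integral_add hF.neg hFE
    rw [h1] at hint
    linear_combination -hint
  have hrest : ‖∫ u in Ioi X, F u * Er u‖ ≤ 2 ^ (s₃.re + 1) * (κ / t) * (X ^ (-σ) / σ) := by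
    refine (norm_integral_le_of_norm_le hmaj hae).trans_eq ?_
    rw [integral_const_mul, integral_Ioi_rpow_of_lt (by linarith) hX, sub_add_cancel,
      neg_div_neg_eq]
  change ‖∫ u in Ioi X, F u‖ ≤ _
  rw [hint2]
  calc _ ≤ 2 ^ (s₃.re + 1) / t * X ^ (-σ) + 2 ^ (s₃.re + 1) * (κ / t) * (X ^ (-σ) / σ) :=
        (norm_add_le _ _).trans (add_le_add (hG X le_rfl) hrest)
    _ = _ := by field_simp

/-- The factor s₃ in front of the integral is offset by the gain 1/t₃ inside it, and the denominator
s₁ + s₃ - 1 contributes the remaining 1/t₃. -/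
lemma exists_norm_avTail_le (s₁ : ℂ) (σ₃ : ℝ) (ht₁ : 0 ≤ s₁.im) (h₃ : 0 ≤ σ₃)
    (hσ : 0 < s₁.re + σ₃) :
    ∃ C : ℝ, 0 ≤ C ∧ ∀ s₃ : ℂ, s₃.re = σ₃ → 1 ≤ s₃.im → ∀ n X : ℝ, 0 ≤ n → n ≤ X → 0 < X →
      ‖avTail s₁ s₃ n X‖ ≤ C * (X * X ^ (-(s₁.re + σ₃)) / s₃.im) := by
  set C₁ := 2 ^ (σ₃ + 1) * (1 + (3 + 2 * (‖s₁‖ + σ₃ + 2)) / (s₁.re + σ₃)) with hC₁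
  refine ⟨2 ^ σ₃ + (σ₃ + 1) * C₁, by positivity, ?_⟩
  rintro s₃ rfl ht₃ n X hn hnX hX
  have ht0 : 0 < s₃.im := by linarith
  have hJ := norm_integral_avKern_add_one_le ht₁ ht₃ h₃ hσ hn hX hnX
  have hk := norm_avKern_le s₁ s₃ hn hnX hX
  rw [abs_of_nonneg h₃] at hk
  have hden : s₃.im ≤ ‖s₁ + s₃ - 1‖ := by
    refine le_trans ?_ ((le_abs_self _).trans (Complex.abs_im_le_norm _))
    simpa using ht₁
  have hn' : ‖(n : ℂ)‖ = n := Complex.norm_of_nonneg hn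
  have h1 : ‖s₃ * n * ∫ u in Ioi X, avKern s₁ (s₃ + 1) n u‖ ≤
      (s₃.re + 1) * s₃.im * X * (C₁ * (X ^ (-(s₁.re + s₃.re)) / s₃.im)) := by
    rw [norm_mul, norm_mul, hn']
    have := norm_le_mul_im h₃ ht₃
    gcongr
  have h2 : ‖avKern (s₁ - 1) s₃ n X‖ ≤ X * (2 ^ s₃.re * X ^ (-(s₁.re + s₃.re))) := by
    rw [avKern_sub_one_left _ _ hX, norm_mul, Complex.norm_of_nonneg hX.le]
    gcongr
  rw [avTail, norm_div]
  calc _ ≤ (X * (2 ^ s₃.re * X ^ (-(s₁.re + s₃.re))) +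
        (s₃.re + 1) * s₃.im * X * (C₁ * (X ^ (-(s₁.re + s₃.re)) / s₃.im))) / s₃.im := by
        gcongr
        exact (norm_add_le _ _).trans (add_le_add h2 h1)
    _ = _ := by field_simp

/-! ### The remainder after truncation -/

/-- The regularised sum over m ≥ X behaves like a convergent one: finitely many terms can be split
off. -/
lemma avTail_add_tsum_avStep {s₁ s₃ : ℂ} {n X : ℝ}
    (h : Summable (fun k : ℕ => avStep s₁ s₃ n (X + k))) (K : ℕ) :
    avTail s₁ s₃ n X + ∑' k : ℕ, avStep s₁ s₃ n (X + k) =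
      ∑ k ∈ Finset.range K, avKern s₁ s₃ n (X + k) +
        (avTail s₁ s₃ n (X + K) + ∑' k : ℕ, avStep s₁ s₃ n (X + K + k)) := by
  rw [← h.sum_add_tsum_nat_add K]
  have hpart : ∑ k ∈ Finset.range K, avStep s₁ s₃ n (X + k) =
      ∑ k ∈ Finset.range K, avKern s₁ s₃ n (X + k) -
        (avTail s₁ s₃ n X - avTail s₁ s₃ n (X + K)) := by
    have := Finset.sum_range_sub' (fun k : ℕ => avTail s₁ s₃ n (X + k)) K
    push_cast at this
    simp only [add_zero, ← add_assoc] at this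
    rw [← this, ← Finset.sum_sub_distrib]
    rfl
  have hshift : ∀ k : ℕ, X + ((k + K : ℕ) : ℝ) = X + K + k := fun k => by push_cast; ring
  simp only [hpart, hshift]
  ring

lemma sum_avInner_eq (s₁ s₂ s₃ : ℂ) (N : ℕ) :
    ∑ m ∈ Finset.Icc 1 N, avInner s₁ s₂ s₃ m =
      ∑ n ∈ Finset.Ico 1 (N + 1), ((n : ℝ) : ℂ) ^ (-s₂) *
        ∑ m ∈ Finset.Ico (n + 1) (N + 1), avKern s₁ s₃ n m := by
  simp only [avInner, one_div_eq_avKern, Finset.mul_sum]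
  refine Finset.sum_comm' fun m n => ?_
  simp only [Finset.mem_Icc, Finset.mem_Ico]
  omega

/-- The difference between the continued double series and its truncation at `N`, as a sum of
tails. -/
lemma avCont_sub_sum_avInner {s₁ s₂ s₃ : ℂ} (hs : 0 < s₁.re + s₃.re)
    (hs' : 1 < s₁.re + s₂.re + s₃.re) (hne : s₁ + s₃ ≠ 1) (hne' : s₁ + s₂ + s₃ ≠ 2) (N : ℕ) :
    avCont s₁ s₂ s₃ - ∑ m ∈ Finset.Icc 1 N, avInner s₁ s₂ s₃ m =
      avTail s₁ s₃ 1 1 * (avTail (s₁ + s₂ + s₃ - 1) 0 0 (N + 1) +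
          ∑' k : ℕ, avStep (s₁ + s₂ + s₃ - 1) 0 0 (N + 1 + k)) -
        2 ^ (-s₃) * ∑' k : ℕ, (((N : ℝ) + 1 + k : ℝ) : ℂ) ^ (-(s₁ + s₂ + s₃)) +
      ∑ n ∈ Finset.Ico 1 (N + 1), ((n : ℝ) : ℂ) ^ (-s₂) *
        (avTail s₁ s₃ n (N + 1) + ∑' k : ℕ, avStep s₁ s₃ n (N + 1 + k)) +
      ∑' j : ℕ, (((N : ℝ) + 1 + j : ℝ) : ℂ) ^ (-s₂) *
        ∑' k : ℕ, avStep s₁ s₃ (N + 1 + j) (N + 1 + j + k) := by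
  set w := s₁ + s₂ + s₃ - 1 with hw
  have hw0 : 0 < w.re := by simp [hw]; linarith
  have hw1 : w ≠ 1 := fun h => hne' (by linear_combination h - hw)
  have hpos : ∀ n : ℕ, (0 : ℝ) < 1 + n := fun n => by positivity
  have hne0 : ∀ n : ℕ, ((1 + n : ℝ) : ℂ) ≠ 0 := fun n => by exact_mod_cast (hpos n).ne'
  have hcast : ∀ j : ℕ, ((j + N : ℕ) : ℝ) + 1 = N + 1 + j := fun j => by push_cast; ring
  have hzeta : zetaCont w = ∑ n ∈ Finset.range N, ((1 + n : ℝ) : ℂ) ^ (-w) +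
      (avTail w 0 0 (N + 1) + ∑' k : ℕ, avStep w 0 0 (N + 1 + k)) := by
    rw [zetaCont, avTail_add_tsum_avStep (summable_avStep_zero hw0 hw1 le_rfl) N]
    simp only [avKern_zero, add_comm (1 : ℝ) (N : ℝ)]
  have hriem : riemannZeta (s₁ + s₂ + s₃) =
      ∑ n ∈ Finset.range N, ((1 + n : ℝ) : ℂ) ^ (-(s₁ + s₂ + s₃)) +
        ∑' k : ℕ, (((N : ℝ) + 1 + k : ℝ) : ℂ) ^ (-(s₁ + s₂ + s₃)) := by
    have hre : 1 < (s₁ + s₂ + s₃).re := by simpa using hs'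
    have hsum : Summable fun n : ℕ => (((n : ℝ) + 1 : ℝ) : ℂ) ^ (-(s₁ + s₂ + s₃)) := by
      refine ((summable_nat_add_iff 1).2 (Complex.summable_one_div_nat_cpow.2 hre)).congr
        fun n => ?_
      rw [one_div, ← Complex.cpow_neg]
      push_cast
      rfl
    have h := hsum.sum_add_tsum_nat_add N
    simp only [hcast] at h
    simp only [add_comm (1 : ℝ)]
    rw [h, zeta_eq_tsum_one_div_nat_add_one_cpow hre]
    refine tsum_congr fun n => ?_
    rw [one_div, ← Complex.cpow_neg]
    push_cast
    rfl
  have hE := summable_avTerm hs hs' hne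
  have hterm : ∑' p, avTerm s₁ s₂ s₃ p =
      ∑ n ∈ Finset.range N, ((1 + n : ℝ) : ℂ) ^ (-s₂) *
          ∑' k : ℕ, avStep s₁ s₃ (1 + n) (1 + n + k) +
        ∑' j : ℕ, (((N : ℝ) + 1 + j : ℝ) : ℂ) ^ (-s₂) *
          ∑' k : ℕ, avStep s₁ s₃ (N + 1 + j) (N + 1 + j + k) := by
    rw [hE.tsum_prod, ← hE.prod.sum_add_tsum_nat_add N]
    simp only [avTerm, tsum_mul_left, hcast, add_comm (1 : ℝ)]
  -- For each index up to `N` the cut is moved from the diagonal to N + 1. The tail at the diagonal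
  -- cancels against a term of `zetaCont`, the diagonal value against one of `riemannZeta`. For
  -- indices beyond `N` both stay in the zeta tails.
  have hinner : ∀ n ∈ Finset.range N, ((1 + n : ℝ) : ℂ) ^ (-s₂) *
      ∑' k : ℕ, avStep s₁ s₃ (1 + n) (1 + n + k) =
      2 ^ (-s₃) * ((1 + n : ℝ) : ℂ) ^ (-(s₁ + s₂ + s₃)) -
        avTail s₁ s₃ 1 1 * ((1 + n : ℝ) : ℂ) ^ (-w) +
      (((1 + n : ℕ) : ℝ) : ℂ) ^ (-s₂) *
        ∑ m ∈ Finset.Ico (1 + n + 1) (N + 1), avKern s₁ s₃ (1 + n : ℕ) m +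
      (((1 + n : ℕ) : ℝ) : ℂ) ^ (-s₂) * (avTail s₁ s₃ (1 + n : ℕ) (N + 1) +
        ∑' k : ℕ, avStep s₁ s₃ (1 + n : ℕ) (N + 1 + k)) := by
    intro n hn
    have hnN : n < N := Finset.mem_range.1 hn
    have h := avTail_add_tsum_avStep (summable_avStep_add_nat (n := 1 + (n : ℝ))
      (X := 1 + (n : ℝ)) (hpos n).le le_rfl (by linarith [n.cast_nonneg (α := ℝ)]) hs hne) (N - n)
    have hX : (1 : ℝ) + n + (N - n : ℕ) = N + 1 := by
      rw [Nat.cast_sub hnN.le]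
      ring
    have hIco : ∑ k ∈ Finset.range (N - n), avKern s₁ s₃ (1 + n) (1 + n + k) =
        avKern s₁ s₃ (1 + n) (1 + n) +
          ∑ m ∈ Finset.Ico (1 + n + 1) (N + 1), avKern s₁ s₃ (1 + n) m := by
      have h1 := Finset.sum_eq_sum_Ico_succ_bot (show 1 + n < N + 1 by omega)
        (fun m : ℕ => avKern s₁ s₃ (1 + n) m)
      rw [Finset.sum_Ico_eq_sum_range, show N + 1 - (1 + n) = N - n by omega] at h1
      push_cast at h1
      exact h1
    rw [hX, hIco, avTail_self _ _ (hpos n), avKern_self _ _ (hpos n)] at h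
    rw [show ((1 + n : ℕ) : ℝ) = 1 + n by push_cast; rfl, eq_sub_of_add_eq' h]
    have e1 : ((1 + n : ℝ) : ℂ) ^ (-(s₁ + s₂ + s₃)) =
        ((1 + n : ℝ) : ℂ) ^ (-s₂) * ((1 + n : ℝ) : ℂ) ^ (-s₁ - s₃) := by
      rw [← Complex.cpow_add _ _ (hne0 n)]
      ring_nf
    have e2 : ((1 + n : ℝ) : ℂ) ^ (-w) =
        ((1 + n : ℝ) : ℂ) ^ (-s₂) * ((1 + n : ℝ) : ℂ) ^ (1 - s₁ - s₃) := by
      rw [← Complex.cpow_add _ _ (hne0 n), hw]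
      ring_nf
    rw [e1, e2]
    ring
  rw [avCont, sum_avInner_eq, hzeta, hriem, hterm, Finset.sum_congr rfl hinner]
  simp only [Finset.sum_add_distrib, Finset.sum_sub_distrib, ← Finset.mul_sum,
    Finset.sum_Ico_eq_sum_range _ 1 (N + 1), Nat.add_sub_cancel]
  ring

/-! ### The error term -/

lemma norm_avTail_zero (w : ℂ) (X : ℝ) (hX : 0 < X) :
    ‖avTail w 0 0 X‖ = X * X ^ (-w.re) / ‖w - 1‖ := by
  rw [avTail, avKern_sub_one_left _ _ hX, avKern_zero]
  simp only [zero_mul, add_zero]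
  rw [norm_div, norm_mul, Complex.norm_of_nonneg hX.le, Complex.norm_cpow_eq_rpow_re_of_pos hX,
    Complex.neg_re]

lemma norm_tsum_le_of_norm_le_rpow {f : ℕ → ℂ} {C τ X : ℝ} (hτ : 0 < τ) (hX : 1 ≤ X)
    (hC : 0 ≤ C) (hf : ∀ k : ℕ, ‖f k‖ ≤ C * (X + k) ^ (-τ - 1)) :
    ‖∑' k, f k‖ ≤ C * (1 + 1 / τ) * X ^ (-τ) := by
  refine (tsum_of_norm_bounded ((summable_add_nat_rpow hτ hX).mul_left C).hasSum hf).trans ?_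
  rw [tsum_mul_left, mul_assoc]
  exact mul_le_mul_of_nonneg_left (tsum_add_nat_rpow_le hτ hX) hC

/-- Write n^{-τ} = n^{3/2-τ} n^{-3/2}; the sum of n^{-3/2} is at most 1 + 1/(1/2) = 3. This crude
bound needs no logarithm for any τ. -/
lemma sum_Ico_rpow_neg_le (τ : ℝ) (N : ℕ) :
    ∑ n ∈ Finset.Ico 1 (N + 1), (n : ℝ) ^ (-τ) ≤ 3 * ((N : ℝ) + 1) ^ max 0 (3 / 2 - τ) := by
  have h := sum_range_rpow_le (τ := 1 / 2) (by norm_num) le_rfl N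
  rw [Real.one_rpow] at h
  rw [Finset.sum_Ico_eq_sum_range, Nat.add_sub_cancel]
  calc ∑ k ∈ Finset.range N, ((1 + k : ℕ) : ℝ) ^ (-τ)
      ≤ ∑ k ∈ Finset.range N, ((N : ℝ) + 1) ^ max 0 (3 / 2 - τ) *
          (1 + (k : ℝ)) ^ (-(1 / 2) - 1 : ℝ) := by
        refine Finset.sum_le_sum fun k hk => ?_
        have hkN : (k : ℝ) < N := by exact_mod_cast Finset.mem_range.1 hk
        have hk1 : (1 : ℝ) ≤ 1 + k := by linarith [k.cast_nonneg (α := ℝ)]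
        have e : ((1 + k : ℕ) : ℝ) ^ (-τ) =
            (1 + (k : ℝ)) ^ (3 / 2 - τ) * (1 + (k : ℝ)) ^ (-(1 / 2) - 1 : ℝ) := by
          rw [← Real.rpow_add (by linarith)]
          push_cast
          congr 1
          ring
        rw [e]
        gcongr
        calc (1 + (k : ℝ)) ^ (3 / 2 - τ) ≤ (1 + (k : ℝ)) ^ max 0 (3 / 2 - τ) :=
              Real.rpow_le_rpow_of_exponent_le hk1 (le_max_right _ _)
          _ ≤ _ := Real.rpow_le_rpow (by linarith) (by linarith) (le_max_left _ _)
    _ ≤ ((N : ℝ) + 1) ^ max 0 (3 / 2 - τ) * 3 := by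
        rw [← Finset.mul_sum]
        gcongr
        linarith
    _ = _ := by ring

/-- For σ₂ ≥ 3/2 a factor t^{1/2} is to spare, and for σ₂ < 3/2 the exponents agree. The 2 is needed
at σ₂ = 3/2, where log t ≥ log 2 > 1/2. -/
lemma rpow_le_two_mul_avErrorOrder (σ₁ σ₂ σ₃ : ℝ) {t : ℝ} (ht : 2 ≤ t) :
    t ^ (max 0 (3 / 2 - σ₂) - (σ₁ + σ₃)) ≤ 2 * avErrorOrder σ₁ σ₂ σ₃ t := by
  have ht1 : 1 ≤ t := by linarith
  have ht0 : 0 < t := by linarith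
  rw [avErrorOrder]
  split_ifs with h1 h2
  · rw [max_eq_left (by linarith)]
    have : t ^ (0 - (σ₁ + σ₃)) ≤ t ^ (1 / 2 - σ₁ - σ₃) :=
      Real.rpow_le_rpow_of_exponent_le ht1 (by linarith)
    linarith [Real.rpow_nonneg ht0.le (1 / 2 - σ₁ - σ₃)]
  · rw [max_eq_left (by linarith)]
    have h3 : t ^ (0 - (σ₁ + σ₃)) ≤ t ^ (1 / 2 - σ₁ - σ₃) :=
      Real.rpow_le_rpow_of_exponent_le ht1 (by linarith)
    have h4 : 1 / 2 ≤ Real.log t := by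
      have := Real.log_le_log two_pos ht
      linarith [Real.log_two_gt_d9]
    nlinarith [Real.rpow_nonneg ht0.le (1 / 2 - σ₁ - σ₃)]
  · rw [max_eq_right (by linarith [lt_of_le_of_ne (not_lt.1 h1) h2])]
    rw [show 3 / 2 - σ₂ - (σ₁ + σ₃) = 3 / 2 - σ₁ - σ₂ - σ₃ by ring]
    linarith [Real.rpow_nonneg ht0.le (3 / 2 - σ₁ - σ₂ - σ₃)]

theorem theorem2p3 (s₁ s₂ : ℂ) (σ₃ : ℝ) (hσ₁ : 0 ≤ s₁.re) (ht₁ : 0 ≤ s₁.im)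
    (hσ₃ : max 0 (max (1 / 2 - s₁.re) (3 / 2 - s₁.re - s₂.re)) < σ₃) :
    IsAVContinuation zetaAV ∧
    ∀ δ : ℝ, 0 < δ → ∃ C : ℝ, ∀ (t₃ : ℝ) (s₃ : ℂ), s₃.re = σ₃ → s₃.im = t₃ → 2 ≤ t₃ →
      s₁ + s₃ ≠ 1 → δ ≤ ‖s₁ + s₂ + s₃ - 2‖ →
        ‖zetaAV s₁ s₂ s₃ - avTruncated (max 1 |s₁.im| * t₃) s₁ s₂ s₃‖
          ≤ C * avErrorOrder s₁.re s₂.re σ₃ t₃ := by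
  refine ⟨isAVContinuation_zetaAV, fun δ hδ => ?_⟩
  have hσ₃0 : 0 < σ₃ := (le_max_left _ _).trans_lt hσ₃
  have hσ' : 3 / 2 - s₁.re - s₂.re < σ₃ :=
    ((le_max_right _ _).trans (le_max_right _ _)).trans_lt hσ₃
  have hσ : 0 < s₁.re + σ₃ := by linarith
  set ρ := s₁.re + s₂.re + σ₃ - 1 with hρ
  have hρ0 : 0 < ρ := by linarith
  set a := max 1 |s₁.im| with ha
  have ha1 : 1 ≤ a := le_max_left _ _
  obtain ⟨CT, hCT0, hCT⟩ := exists_norm_avTail_le s₁ σ₃ ht₁ hσ₃0.le hσ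
  obtain ⟨CH, hCH0, hCH⟩ := exists_norm_tsum_avStep_le s₁ σ₃ hσ₁ ht₁ hσ₃0.le hσ
  set W := ‖s₁‖ + ‖s₂‖ + σ₃ + 2 with hW
  set β := max 0 (3 / 2 - s₂.re) with hβ
  -- `D₁` collects the terms of size X^{-ρ}, `D₂` those with n ≤ N; (2a)^β comes from X ≤ 2a t₃.
  set D₁ := CT * (2 * a / δ + 2 * W * (1 + 1 / ρ)) + 2 ^ (-σ₃) * (1 * (1 + 1 / ρ)) +
    CH * (1 + 1 / ρ) with hD₁
  set D₂ := (CT * (2 * a) + CH) * (3 * (2 * a) ^ β) with hD₂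
  have hD₁0 : 0 ≤ D₁ := by positivity
  have hD₂0 : 0 ≤ D₂ := by positivity
  refine ⟨2 * (D₁ + D₂), ?_⟩
  rintro t₃ s₃ hre him ht hne hδs
  have ht0 : 0 < t₃ := by linarith
  have hne' : s₁ + s₂ + s₃ ≠ 2 := fun h => by
    rw [h, sub_self, norm_zero] at hδs
    linarith
  have hdom : (s₁, s₂, s₃) ∈ avDomain := by
    refine ⟨?_, ?_, hne, hne'⟩ <;> simp only [hre] <;> linarith
  have heq : zetaAV s₁ s₂ s₃ = avCont s₁ s₂ s₃ :=
    isAVContinuation_zetaAV.eq isAVContinuation_avCont hdom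
  have hid := avCont_sub_sum_avInner (s₁ := s₁) (s₂ := s₂) (s₃ := s₃) hdom.1 hdom.2.1 hne hne'
    ⌊a * t₃⌋₊
  rw [heq, avTruncated, hid]
  set N := ⌊a * t₃⌋₊ with hN
  set w := s₁ + s₂ + s₃ - 1 with hw
  have hwre : w.re = ρ := by simp [hw, hρ, hre]
  set X : ℝ := (N : ℝ) + 1 with hX
  have hXat : a * t₃ ≤ X := (Nat.lt_floor_add_one _).le
  have hat : t₃ ≤ a * t₃ := le_mul_of_one_le_left ht0.le ha1
  have htX : t₃ ≤ X := hat.trans hXat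
  have hX1 : 1 ≤ X := by linarith
  have hX0 : 0 < X := by linarith
  have hX2 : X ≤ 2 * a * t₃ := by
    have := Nat.floor_le (show 0 ≤ a * t₃ by positivity)
    rw [hX]
    linarith
  have hXt : X / t₃ ≤ 2 * a := by rwa [div_le_iff₀ ht0]
  have hwne : w ≠ 1 := fun h => hne' (by linear_combination h - hw)
  have hwW : ‖w‖ ≤ W * t₃ := by
    have h1 : ‖w‖ ≤ ‖s₁‖ + ‖s₂‖ + ‖s₃‖ + 1 := by
      refine (norm_sub_le _ _).trans ?_
      rw [norm_one]
      linarith [norm_add₃_le (a := s₁) (b := s₂) (c := s₃)]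
    have h2 := norm_le_mul_im (s₃ := s₃) (by linarith) (by linarith)
    rw [hre, him] at h2
    nlinarith [norm_nonneg s₁, norm_nonneg s₂]
  have hI : ‖avTail s₁ s₃ 1 1‖ ≤ CT / t₃ := by
    have := hCT s₃ hre (by linarith) 1 1 zero_le_one le_rfl one_pos
    rwa [Real.one_rpow, him, mul_one, mul_one_div] at this
  -- Here the distance δ from the hyperplane enters: the denominator is w - 1 = s₁ + s₂ + s₃ - 2.
  have hz1 : ‖avTail w 0 0 X‖ ≤ X * X ^ (-ρ) / δ := by
    rw [norm_avTail_zero w X hX0, hwre]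
    have : w - 1 = s₁ + s₂ + s₃ - 2 := by rw [hw]; ring
    rw [this]
    gcongr
  have hz2 : ‖∑' k : ℕ, avStep w 0 0 (X + k)‖ ≤ 2 * (W * t₃) * (1 + 1 / ρ) * X ^ (-ρ) := by
    refine norm_tsum_le_of_norm_le_rpow hρ0 hX1 (by positivity) fun k => ?_
    have := norm_avStep_zero_le (w := w) (by linarith) hwne (x := X + k) (by positivity)
    rw [hwre] at this
    exact this.trans (by gcongr)
  -- The factor 1/t₃ of `avTail s₁ s₃ 1 1` absorbs both X ≤ 2a t₃ and ‖w‖ ≤ W t₃.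
  have hE₁ : ‖avTail s₁ s₃ 1 1 * (avTail w 0 0 X + ∑' k : ℕ, avStep w 0 0 (X + k))‖ ≤
      CT * (2 * a / δ + 2 * W * (1 + 1 / ρ)) * X ^ (-ρ) := by
    rw [norm_mul]
    calc _ ≤ CT / t₃ * (X * X ^ (-ρ) / δ + 2 * (W * t₃) * (1 + 1 / ρ) * X ^ (-ρ)) := by
          gcongr
          exact (norm_add_le _ _).trans (add_le_add hz1 hz2)
      _ = CT * (X / t₃ / δ + 2 * W * (1 + 1 / ρ)) * X ^ (-ρ) := by field_simp
      _ ≤ _ := by gcongr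
  have hE₂ : ‖(2 : ℂ) ^ (-s₃) * ∑' k : ℕ, ((X + k : ℝ) : ℂ) ^ (-(s₁ + s₂ + s₃))‖ ≤
      2 ^ (-σ₃) * (1 * (1 + 1 / ρ)) * X ^ (-ρ) := by
    have h2 : ‖(2 : ℂ) ^ (-s₃)‖ = 2 ^ (-σ₃) := by
      have := Complex.norm_cpow_eq_rpow_re_of_pos two_pos (-s₃)
      simpa [hre] using this
    rw [norm_mul, h2, mul_assoc]
    refine mul_le_mul_of_nonneg_left ?_ (by positivity)
    refine norm_tsum_le_of_norm_le_rpow hρ0 hX1 zero_le_one fun k => ?_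
    rw [Complex.norm_cpow_eq_rpow_re_of_pos (by positivity), one_mul]
    refine le_of_eq ?_
    congr 1
    simp [hre, hρ]
  have hE₃ : ‖∑ n ∈ Finset.Ico 1 (N + 1), ((n : ℝ) : ℂ) ^ (-s₂) *
      (avTail s₁ s₃ n X + ∑' k : ℕ, avStep s₁ s₃ n (X + k))‖ ≤
      (CT * (2 * a) + CH) * (3 * X ^ β) * X ^ (-(s₁.re + σ₃)) := by
    refine (norm_sum_le _ _).trans ?_
    calc _ ≤ ∑ n ∈ Finset.Ico 1 (N + 1), (n : ℝ) ^ (-s₂.re) *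
          ((CT * (2 * a) + CH) * X ^ (-(s₁.re + σ₃))) := by
          refine Finset.sum_le_sum fun n hn => ?_
          obtain ⟨hn1, hnN⟩ := Finset.mem_Ico.1 hn
          have hn0 : (0 : ℝ) < n := by exact_mod_cast hn1
          have hnX : (n : ℝ) ≤ X := by
            rw [hX]
            exact_mod_cast hnN.le
          have hT := hCT s₃ hre (by linarith) n X hn0.le hnX hX0
          have hH := hCH s₃ hre (by linarith) n X hn0.le hnX (by rwa [him])
          rw [norm_mul, Complex.norm_cpow_eq_rpow_re_of_pos hn0, Complex.neg_re]
          refine mul_le_mul_of_nonneg_left ?_ (by positivity)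
          refine (norm_add_le _ _).trans ?_
          rw [him] at hT
          calc _ ≤ CT * (X * X ^ (-(s₁.re + σ₃)) / t₃) + CH * X ^ (-(s₁.re + σ₃)) :=
                add_le_add hT hH
            _ = (CT * (X / t₃) + CH) * X ^ (-(s₁.re + σ₃)) := by ring
            _ ≤ _ := by gcongr
      _ = (CT * (2 * a) + CH) * (∑ n ∈ Finset.Ico 1 (N + 1), (n : ℝ) ^ (-s₂.re)) *
          X ^ (-(s₁.re + σ₃)) := by
          rw [← Finset.sum_mul]
          ring
      _ ≤ _ := by
          have := sum_Ico_rpow_neg_le s₂.re N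
          gcongr
  have hE₄ : ‖∑' j : ℕ, ((X + j : ℝ) : ℂ) ^ (-s₂) *
      ∑' k : ℕ, avStep s₁ s₃ (X + j) (X + j + k)‖ ≤ CH * (1 + 1 / ρ) * X ^ (-ρ) := by
    refine norm_tsum_le_of_norm_le_rpow hρ0 hX1 hCH0 fun j => ?_
    have hXj : X ≤ X + j := by linarith [j.cast_nonneg (α := ℝ)]
    have hXj0 : 0 < X + j := by linarith
    have hH := hCH s₃ hre (by linarith) (X + j) (X + j) hXj0.le le_rfl
      (by rw [him]; exact hXat.trans hXj)
    rw [norm_mul, Complex.norm_cpow_eq_rpow_re_of_pos hXj0, Complex.neg_re]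
    calc _ ≤ (X + j) ^ (-s₂.re) * (CH * (X + j) ^ (-(s₁.re + σ₃))) := by gcongr
      _ = CH * ((X + j) ^ (-s₂.re) * (X + j) ^ (-(s₁.re + σ₃))) := by ring
      _ = _ := by
        rw [← Real.rpow_add hXj0, hρ]
        ring_nf
  -- Here -ρ = 1 - σ₂ - (σ₁ + σ₃), and 1 - σ₂ < 3/2 - σ₂ ≤ β.
  have hXρ : X ^ (-ρ) ≤ t₃ ^ (β - (s₁.re + σ₃)) := by
    refine (Real.rpow_le_rpow_of_nonpos ht0 htX (by linarith)).trans
      (Real.rpow_le_rpow_of_exponent_le (by linarith) ?_)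
    linarith [le_max_right 0 (3 / 2 - s₂.re)]
  have hXβ : X ^ β * X ^ (-(s₁.re + σ₃)) ≤ (2 * a) ^ β * t₃ ^ (β - (s₁.re + σ₃)) := by
    have hβ0 : 0 ≤ β := le_max_left _ _
    calc _ ≤ (2 * a * t₃) ^ β * t₃ ^ (-(s₁.re + σ₃)) := by
          refine mul_le_mul (Real.rpow_le_rpow hX0.le hX2 hβ0)
            (Real.rpow_le_rpow_of_nonpos ht0 htX (by linarith)) (by positivity) (by positivity)
      _ = _ := by
        rw [Real.mul_rpow (by positivity) ht0.le, mul_assoc, ← Real.rpow_add ht0,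
          ← sub_eq_add_neg]
  have hfinal := rpow_le_two_mul_avErrorOrder s₁.re s₂.re σ₃ ht
  calc _ ≤ CT * (2 * a / δ + 2 * W * (1 + 1 / ρ)) * X ^ (-ρ) +
        2 ^ (-σ₃) * (1 * (1 + 1 / ρ)) * X ^ (-ρ) +
        (CT * (2 * a) + CH) * (3 * X ^ β) * X ^ (-(s₁.re + σ₃)) +
        CH * (1 + 1 / ρ) * X ^ (-ρ) := by
        refine (norm_add_le _ _).trans (add_le_add ?_ hE₄)
        refine (norm_add_le _ _).trans (add_le_add ?_ hE₃)
        exact (norm_sub_le _ _).trans (add_le_add hE₁ hE₂)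
    _ = D₁ * X ^ (-ρ) + (CT * (2 * a) + CH) * 3 * (X ^ β * X ^ (-(s₁.re + σ₃))) := by
        rw [hD₁]
        ring
    _ ≤ D₁ * t₃ ^ (β - (s₁.re + σ₃)) +
        (CT * (2 * a) + CH) * 3 * ((2 * a) ^ β * t₃ ^ (β - (s₁.re + σ₃))) := by gcongr
    _ = (D₁ + D₂) * t₃ ^ (β - (s₁.re + σ₃)) := by
        rw [hD₂]
        ring
    _ ≤ (D₁ + D₂) * (2 * avErrorOrder s₁.re s₂.re σ₃ t₃) := by gcongr
    _ = _ := by ring
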